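/- Let $w_1,\dots,w_N$ be positive integers with $\gcd(w_1,\dots,w_N)=1$, let $d=w_1+\cdots+w_N$, and assume that $w_j$ divides $d$ for every $j$. Put $q_i=w_i/d$ and $v_{\rm c}=d^{-d}\prod_{j=1}^N w_j^{w_j}$. Let $\mathcal{M}^\circ=\mathbb{C}\setminus\{0,v_{\rm c}\}$ with coordinate $v$, and regard $\mathcal{M}^\circ\times\mathbb{C}_z\times\mathbb{C}_\lambda$ as the affine variety with coordinate ring $\mathbb{C}[z,\lambda,v^{\pm1},(v-v_{\rm c})^{-1}]$ and structure sheaf $\mathcal{O}$. Let $D_v=v\,\partial/\partial v$ and let $$\mathcal{R}^{\rm tw}=\mathbb{C}\langle z,\lambda,v^{\pm1},(v-v_{\rm c})^{-1},zD_v\rangle$$ be the ring of differential operators generated by the functions on the base and by $zD_v$. Set $$B=\{(\nu_0,\dots,\nu_N)\in\mathbb{Z}^{N+1} : \nu_i+q_i\nu_0\ge 0,\ i=1,\dots,N\}.$$ Let $\mathcal{F}^{\rm tw}$ be the quasi-coherent sheaf on $\mathcal{M}^\circ\times\mathbb{C}_z\times\mathbb{C}_\lambda$ whose module of global sections is the left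 $\mathcal{R}^{\rm tw}$-module generated by symbols $\triangle_\nu$, $\nu\in B$, subject to the relations $$(d\,zD_v+\lambda+(\nu_0+1)z)\triangle_\nu=\triangle_{\nu+e_0},\qquad (w_i\,zD_v-\nu_i z)\triangle_\nu=\triangle_{\nu+e_i}\ (1\le i\le N),\qquad v\,\triangle_\nu=\triangle_{\nu+(-d,w_1,\dots,w_N)}$$ for all $\nu\in B$, where $e_0,\dots,e_N$ is the standard basis of $\mathbb{Z}^{N+1}$. For $l\ge 0$ put $\nu(l)=(l,-\lfloor q_1 l\rfloor,\dots,-\lfloor q_N l\rfloor)\in B$. Then $\mathcal{F}^{\rm tw}$ is a free $\mathcal{O}$-module of rank $d$ with basis $\triangle_{\nu(0)},\dots,\triangle_{\nu(d-1)}$. That is, these elements form a basis of the module of global sections over $\mathbb{C}[z,\lambda,v^{\pm1},(v-v_{\rm c})^{-1}]$, and over every Zariski open subset $U$ their restrictions form a basis of $\mathcal{F}^{\rm tw}(U)$ over $\mathcal{O}(U)$. -/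

import Mathlib

open AlgebraicGeometry

noncomputable section

namespace GKZ

/-- The conifold value `v_c = d^{-d} ∏_j w_j^{w_j}`. -/
def conifold {N : ℕ} (d : ℕ) (w : Fin N → ℕ) : ℂ :=
  ((d : ℂ) ^ d)⁻¹ * ∏ j, (w j : ℂ) ^ w j

/-- The rational numbers `q_i = w_i / d`. -/
def q {N : ℕ} (d : ℕ) (w : Fin N → ℕ) (i : Fin N) : ℚ := (w i : ℚ) / (d : ℚ)

/-! ### The base `M° × ℂ_z × ℂ_λ`, where `M° = ℂ ∖ {0, v_c}` with coordinate `v` -/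

/-- The function `v (v - v_c)`; the polynomial variables `0, 1, 2` are `v, z, λ`. -/
def discr {N : ℕ} (d : ℕ) (w : Fin N → ℕ) : MvPolynomial (Fin 3) ℂ :=
  MvPolynomial.X 0 * (MvPolynomial.X 0 - MvPolynomial.C (conifold d w))

/-- The coordinate ring `ℂ[z, λ, v^{±1}, (v - v_c)^{-1}]` of the affine variety
`(ℂ ∖ {0, v_c}) × ℂ_z × ℂ_λ`. -/
def BaseRing {N : ℕ} (d : ℕ) (w : Fin N → ℕ) : Type := Localization.Away (discr d w)

section Base

variable {N : ℕ} (d : ℕ) (w : Fin N → ℕ)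

instance : CommRing (BaseRing d w) := inferInstanceAs (CommRing (Localization.Away (discr d w)))

instance : Algebra (MvPolynomial (Fin 3) ℂ) (BaseRing d w) :=
  inferInstanceAs (Algebra (MvPolynomial (Fin 3) ℂ) (Localization.Away (discr d w)))

instance : Algebra ℂ (BaseRing d w) :=
  inferInstanceAs (Algebra ℂ (Localization.Away (discr d w)))

instance : IsScalarTower ℂ (MvPolynomial (Fin 3) ℂ) (BaseRing d w) :=
  inferInstanceAs (IsScalarTower ℂ (MvPolynomial (Fin 3) ℂ) (Localization.Away (discr d w)))

instance : IsLocalization.Away (discr d w) (BaseRing d w) :=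
  inferInstanceAs (IsLocalization.Away (discr d w) (Localization.Away (discr d w)))

/-- The coordinate functions on the base: `coord 0 = v`, `coord 1 = z`, `coord 2 = λ`. -/
def coord (i : Fin 3) : BaseRing d w :=
  algebraMap (MvPolynomial (Fin 3) ℂ) (BaseRing d w) (MvPolynomial.X i)

/-- The coordinate `v`. -/
abbrev v : BaseRing d w := coord d w 0

/-- The coordinate `z`. -/
abbrev z : BaseRing d w := coord d w 1

/-- The coordinate `λ`. -/
abbrev lam : BaseRing d w := coord d w 2

/-- Auxiliary: the homomorphism `f ↦ f + ε v ∂f/∂v` into dual numbers, on polynomials. -/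
def dualPoly : MvPolynomial (Fin 3) ℂ →ₐ[ℂ] TrivSqZeroExt (BaseRing d w) (BaseRing d w) :=
  MvPolynomial.aeval fun i =>
    TrivSqZeroExt.inl (coord d w i) + TrivSqZeroExt.inr (if i = 0 then v d w else 0)

theorem fst_dualPoly (f : MvPolynomial (Fin 3) ℂ) :
    (dualPoly d w f).fst = algebraMap (MvPolynomial (Fin 3) ℂ) (BaseRing d w) f := by
  have h : (TrivSqZeroExt.fstHom ℂ (BaseRing d w) (BaseRing d w)).comp (dualPoly d w) =
      IsScalarTower.toAlgHom ℂ (MvPolynomial (Fin 3) ℂ) (BaseRing d w) := by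
    apply MvPolynomial.algHom_ext
    intro i
    by_cases hi : i = 0 <;> simp [dualPoly, coord, hi]
  exact DFunLike.congr_fun h f

/-- Auxiliary: the homomorphism `f ↦ f + ε v ∂f/∂v` into dual numbers, on the base ring. -/
def dualLift : BaseRing d w →ₐ[ℂ] TrivSqZeroExt (BaseRing d w) (BaseRing d w) :=
  IsLocalization.liftAlgHom
    (M := Submonoid.powers (discr d w))
    (f := dualPoly d w) (fun y => by
      rw [TrivSqZeroExt.isUnit_iff_isUnit_fst, fst_dualPoly]
      exact IsLocalization.map_units (BaseRing d w) y)

theorem dualLift_algebraMap (f : MvPolynomial (Fin 3) ℂ) :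
    dualLift d w (algebraMap (MvPolynomial (Fin 3) ℂ) (BaseRing d w) f) = dualPoly d w f := by
  simp [dualLift]

theorem fst_dualLift (f : BaseRing d w) : (dualLift d w f).fst = f := by
  have h : (TrivSqZeroExt.fstHom ℂ (BaseRing d w) (BaseRing d w)).comp (dualLift d w) =
      AlgHom.id ℂ (BaseRing d w) := by
    apply IsLocalization.algHom_ext (Submonoid.powers (discr d w))
    apply MvPolynomial.algHom_ext
    intro i
    change (dualLift d w (algebraMap (MvPolynomial (Fin 3) ℂ) (BaseRing d w)
      (MvPolynomial.X i))).fst = algebraMap _ _ (MvPolynomial.X i)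
    rw [dualLift_algebraMap, fst_dualPoly]
  exact DFunLike.congr_fun h f

/-- The derivation `D_v = v ∂/∂v` of the base ring. -/
def Dv : Derivation ℂ (BaseRing d w) (BaseRing d w) :=
  Derivation.mk'
    ((TrivSqZeroExt.sndHom (BaseRing d w) (BaseRing d w)).restrictScalars ℂ ∘ₗ
      (dualLift d w).toLinearMap)
    (fun a b => by simp [fst_dualLift, mul_comm])

/-- `D_v` is the `ℂ`-linear derivation with `D_v v = v`, `D_v z = 0`, `D_v λ = 0`. -/
theorem Dv_coord (i : Fin 3) : Dv d w (coord d w i) = if i = 0 then v d w else 0 := by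
  change (dualLift d w (algebraMap (MvPolynomial (Fin 3) ℂ) (BaseRing d w)
    (MvPolynomial.X i))).snd = _
  rw [dualLift_algebraMap]
  unfold dualPoly
  rw [MvPolynomial.aeval_X, TrivSqZeroExt.snd_add, TrivSqZeroExt.snd_inl, TrivSqZeroExt.snd_inr,
    zero_add]

/-- The operator `z D_v` on functions. -/
def zDvEnd : Module.End ℂ (BaseRing d w) :=
  Algebra.lmul ℂ (BaseRing d w) (z d w) * (Dv d w : BaseRing d w →ₗ[ℂ] BaseRing d w)

/-- The ring `ℂ⟨z, λ, v^{±1}, (v - v_c)^{-1}, z D_v⟩` of differential operators: the algebra of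
operators on functions generated by the multiplications by functions and by `z D_v`. -/
def RtwSubalgebra : Subalgebra ℂ (Module.End ℂ (BaseRing d w)) :=
  Algebra.adjoin ℂ (Set.range (Algebra.lmul ℂ (BaseRing d w)) ∪ {zDvEnd d w})

/-- The ring of differential operators `R^tw`. -/
def Rtw : Type := RtwSubalgebra d w

instance : Ring (Rtw d w) := inferInstanceAs (Ring (RtwSubalgebra d w))

instance : Algebra ℂ (Rtw d w) := inferInstanceAs (Algebra ℂ (RtwSubalgebra d w))

/-- Functions, as differential operators of order zero. -/
def ofFun : BaseRing d w →ₐ[ℂ] Rtw d w :=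
  (Algebra.lmul ℂ (BaseRing d w)).codRestrict (RtwSubalgebra d w)
    (fun f => Algebra.subset_adjoin (Or.inl ⟨f, rfl⟩))

/-- The element `z D_v` of the ring of differential operators. -/
def zDv : Rtw d w := ⟨zDvEnd d w, Algebra.subset_adjoin (Or.inr rfl)⟩

end Base

/-! ### The index set and the module -/

section Module

variable {N : ℕ} (d : ℕ) (w : Fin N → ℕ)

/-- The set `B` of `ν = (ν_0, …, ν_N) ∈ ℤ^{N+1}` with `ν_i + q_i ν_0 ≥ 0` for `i = 1, …, N`. -/
def B : Set (Fin (N + 1) → ℤ) :=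
  {ν | ∀ i : Fin N, 0 ≤ (ν i.succ : ℚ) + q d w i * (ν 0 : ℚ)}

/-- The vector `(-d, w_1, …, w_N)`. -/
def relVec : Fin (N + 1) → ℤ := Fin.cons (-(d : ℤ)) fun i => (w i : ℤ)

/-- The vector `ν(l) = (l, -⌊q_1 l⌋, …, -⌊q_N l⌋)`. -/
def nuVec (l : ℕ) : Fin (N + 1) → ℤ := Fin.cons (l : ℤ) fun i => -⌊q d w i * (l : ℚ)⌋

theorem q_nonneg (i : Fin N) : 0 ≤ q d w i := by
  unfold q; positivity

theorem add_single_mem {ν : Fin (N + 1) → ℤ} (hν : ν ∈ B d w) (j : Fin (N + 1)) :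
    ν + Pi.single j 1 ∈ B d w := by
  intro i
  have h := hν i
  have hs : ∀ k : Fin (N + 1), (0 : ℚ) ≤ ((Pi.single j (1 : ℤ) : Fin (N + 1) → ℤ) k : ℚ) := by
    intro k
    by_cases hk : k = j
    · subst hk; simp
    · simp [hk]
  have h1 := hs i.succ
  have h2 := mul_nonneg (q_nonneg d w i) (hs 0)
  simp only [Pi.add_apply, Int.cast_add, mul_add]
  linarith

theorem add_relVec_mem {ν : Fin (N + 1) → ℤ} (hν : ν ∈ B d w) : ν + relVec d w ∈ B d w := by
  intro i
  have h := hν i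
  have hq : q d w i * (d : ℚ) ≤ (w i : ℚ) := by
    unfold q
    rcases eq_or_ne (d : ℚ) 0 with hd | hd
    · rw [hd]; simp
    · rw [div_mul_cancel₀ _ hd]
  simp only [Pi.add_apply, relVec, Fin.cons_zero, Fin.cons_succ, Int.cast_add, Int.cast_neg,
    Int.cast_natCast, mul_add, mul_neg]
  linarith

theorem nuVec_mem (l : ℕ) : nuVec d w l ∈ B d w := by
  intro i
  have h := Int.floor_le (q d w i * (l : ℚ))
  simp only [nuVec, Fin.cons_zero, Fin.cons_succ, Int.cast_neg, Int.cast_natCast]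
  linarith

/-- The free left module over the ring of differential operators on symbols indexed by `B`. -/
abbrev FreeModule : Type := B d w →₀ Rtw d w

/-- The symbol indexed by `ν`, in the free module. -/
def symbol (ν : B d w) : FreeModule d w := Finsupp.single ν 1

/-- The relations `(d z D_v + λ + (ν_0 + 1) z) Δ_ν = Δ_{ν + e_0}`,
`(w_i z D_v - ν_i z) Δ_ν = Δ_{ν + e_i}` for `i = 1, …, N` and
`v Δ_ν = Δ_{ν + (-d, w_1, …, w_N)}`, for `ν ∈ B`. -/
inductive IsRelation : FreeModule d w → Prop
  | zeroth (ν : B d w) : IsRelation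
      (((d : Rtw d w) * zDv d w + ofFun d w (lam d w)
          + ((ν.1 0 + 1 : ℤ) : Rtw d w) * ofFun d w (z d w)) • symbol d w ν
        - symbol d w ⟨ν.1 + Pi.single 0 1, add_single_mem d w ν.2 0⟩)
  | succ (ν : B d w) (i : Fin N) : IsRelation
      (((w i : Rtw d w) * zDv d w
          - ((ν.1 i.succ : ℤ) : Rtw d w) * ofFun d w (z d w)) • symbol d w ν
        - symbol d w ⟨ν.1 + Pi.single i.succ 1, add_single_mem d w ν.2 i.succ⟩)
  | mulv (ν : B d w) : IsRelation
      (ofFun d w (v d w) • symbol d w ν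
        - symbol d w ⟨ν.1 + relVec d w, add_relVec_mem d w ν.2⟩)

/-- The left module of global sections of `F^tw`: generators `Δ_ν`, `ν ∈ B`, modulo the relations
above. -/
def Ftw : Type := FreeModule d w ⧸ Submodule.span (Rtw d w) {x | IsRelation d w x}

instance : AddCommGroup (Ftw d w) :=
  inferInstanceAs (AddCommGroup (FreeModule d w ⧸ Submodule.span (Rtw d w) {x | IsRelation d w x}))

instance : Module (Rtw d w) (Ftw d w) :=
  inferInstanceAs (Module (Rtw d w)
    (FreeModule d w ⧸ Submodule.span (Rtw d w) {x | IsRelation d w x}))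

/-- Functions act on `F^tw` as differential operators of order zero. -/
instance : Module (BaseRing d w) (Ftw d w) :=
  Module.compHom (Ftw d w) (ofFun d w).toRingHom

/-- The generator `Δ_ν`. -/
def Delta (ν : B d w) : Ftw d w :=
  Submodule.Quotient.mk (p := Submodule.span (Rtw d w) {x | IsRelation d w x}) (symbol d w ν)

/-- The generator `Δ_{ν(l)}`. -/
def DeltaNu (l : ℕ) : Ftw d w := Delta d w ⟨nuVec d w l, nuVec_mem d w l⟩

/-- The base `M° × ℂ_z × ℂ_λ` as an affine scheme. -/
abbrev Base : Scheme := Spec (CommRingCat.of (BaseRing d w))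

/-- The sheaf `F^tw` of `𝒪`-modules on the affine base: the quasi-coherent sheaf whose module of
global sections is `Ftw`. -/
def FtwSheaf : (Base d w).Modules := tilde (ModuleCat.of (BaseRing d w) (Ftw d w))

/-- The restriction to an open set `U` of the global section given by an element of `Ftw`. -/
def toSection (U : (Base d w).Opens) (m : Ftw d w) : Γ(FtwSheaf d w, U) :=
  (tilde.toOpen (ModuleCat.of (BaseRing d w) (Ftw d w)) U).hom m

end Module

end GKZ

end

/-!
The proof describes `F^tw` by generators indexed by the integers and then argues with leading
terms.

* *Normal form.* Every element of `R^tw` is `∑ f_k (z D_v)^k` for a unique polynomial `∑ f_k X^k`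
  (`GKZ.op_injective`, `GKZ.op_surjective`). Right multiplication by an operator whose coefficients
  are killed by `D_v` is multiplication of polynomials (`GKZ.op_mul`), and moving `v` to the left of
  an operator is the Taylor shift `X ↦ X + z` (`GKZ.op_mul_v`).

* *Reduction to a cycle.* Every `ν ∈ B` is `ν(l) + (0, k)` for `l = ν_0 ∈ ℤ` and a vector `k` of
  natural numbers. So `F^tw` is generated by the `Δ_{ν(l)}`, `l ∈ ℤ`, subject to
  `Δ_{ν(l + d)} = v⁻¹ Δ_{ν(l)}` and to `A_l Δ_{ν(l)} = B_l Δ_{ν(l + 1)}`, where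
  `A_l = d z D_v + λ + (l + 1) z`, and `B_l` is a product of operators `w_i z D_v - m z`, one for
  each unit by which some `⌊q_i l⌋` increases from `l` to `l + 1`.

* *Grading.* The age `a(l) = l - ∑ ⌊q_i l⌋` is a natural number, periodic with period `d`, because
  `∑ q_i = 1`, and `a(l + 1) + ord B_l = a(l) + 1`. Hence the relations are homogeneous to
  leading order when `Δ_{ν(l)}` has degree `a(l)` and `z D_v` has degree `1`. Going once round the
  cycle multiplies leading terms by `d^d` on one side and by `v⁻¹ ∏ w_i^{w_i}` on the other; the
  difference of the two is a unit exactly because `v` and `v - v_c` are invertible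
  (`GKZ.isUnit_discriminant`).

* *Generation* (`GKZ.span_DeltaNu`). By induction on the degree, a leading term
  `(z D_v)^{k - a(l)} Δ_{ν(l)}` of degree `k` is pushed along the relations until it reaches an
  index of age `k`, where it is a function times a generator, or until it has gone round the cycle,
  where it is killed by a unit.

* *Independence* (`GKZ.linearIndependent_DeltaNu`). The free module on the symbols maps to
  `(R^tw)^d`, and relations go to combinations `∑ p_l ρ_l` of the `d` cyclic relations `ρ_l`
  (`GKZ.toModel_mem_of_isRelation`). If such a combination has order zero in every coordinate, then
  comparing the terms of top degree shows, again by going round the cycle, that all `p_l` vanish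
  (`GKZ.eq_zero_of_cyclic_system`).

The statement on open subsets holds for any module with a finite basis: sections of `M~` are
families of elements of the localizations that are locally fractions, and the coordinate functionals
act on them pointwise (`AlgebraicGeometry.StructureSheaf.exists_basis_sections`).
-/

/-! ### Sections of the sheaf of a module with a finite basis -/

namespace LocalizedModule

variable {R M : Type*} [CommRing R] [AddCommGroup M] [Module R M] {S : Submonoid R}

/-- A map of localizations that is given on fractions by a linear form is linear over the localized
ring. -/
theorem map_smul_of_map_mk (f : M →ₗ[R] R) (φ : LocalizedModule S M → Localization S)
    (hφ : ∀ m t, φ (mk m t) = Localization.mk (f m) t) (r : Localization S)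
    (s : LocalizedModule S M) : φ (r • s) = r * φ s := by
  induction r using Localization.induction_on with | _ r
  induction s using LocalizedModule.induction_on with | _ s t
  rw [mk_smul_mk, hφ, hφ, Localization.mk_mul, map_smul, smul_eq_mul]

/-- The expansion in a basis persists in a localization. -/
theorem sum_coord_smul_mk {ι : Type*} [Fintype ι] (b : Module.Basis ι R M)
    (φ : ι → LocalizedModule S M → Localization S)
    (hφ : ∀ i m t, φ i (mk m t) = Localization.mk (b.coord i m) t) (s : LocalizedModule S M) :
    ∑ i, φ i s • (mk (b i) 1 : LocalizedModule S M) = s := by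
  induction s using LocalizedModule.induction_on with | _ m t
  have h : ∀ i, φ i (mk m t) • (mk (b i) 1 : LocalizedModule S M) =
      divBy t (mkLinearMap S M (b.repr m i • b i)) := by
    intro i
    rw [hφ, mk_smul_mk, mkLinearMap_apply, divBy_apply, liftOn_mk, mul_one, one_mul,
      b.coord_apply]
  rw [Finset.sum_congr rfl fun i _ => h i, ← map_sum, ← map_sum, b.sum_repr, mkLinearMap_apply,
    divBy_apply, liftOn_mk, one_mul]

end LocalizedModule

namespace AlgebraicGeometry.StructureSheaf

universe u

variable {R : Type u} [CommRing R] {M : Type u} [AddCommGroup M] [Module R M]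

theorem comapₗ_smul_section (f : M →ₗ[R] R) (U : TopologicalSpace.Opens (PrimeSpectrum.Top R))
    (r : (structureSheafInType R R).obj.obj (.op U))
    (s : (structureSheafInType R M).obj.obj (.op U)) :
    comapₗ f U U subset_rfl (r • s) = r * comapₗ f U U subset_rfl s :=
  Subtype.ext <| funext fun (x : U) => LocalizedModule.map_smul_of_map_mk f
    (Localizations.comapFun f x.1) (Localizations.comapFun_mk f x.1) (r.1 x) (s.1 x)

theorem sum_comapₗ_coord_smul {ι : Type*} [Fintype ι] (b : Module.Basis ι R M)
    (U : TopologicalSpace.Opens (PrimeSpectrum.Top R))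
    (s : (structureSheafInType R M).obj.obj (.op U)) :
    ∑ i, (comapₗ (b.coord i) U U subset_rfl s) • toOpenₗ R M U (b i) = s := by
  refine Subtype.ext <| funext fun (x : U) => ?_
  refine Eq.trans ?_ (LocalizedModule.sum_coord_smul_mk b
    (fun i => Localizations.comapFun (b.coord i) x.1)
    (fun i => Localizations.comapFun_mk (b.coord i) x.1) (s.1 x))
  have := (show PrimeSpectrum R from x.1).2
  let ev : (structureSheafInType R M).obj.obj (.op U) →+
      LocalizedModule (show PrimeSpectrum R from x.1).asIdeal.primeCompl M :=
    { toFun := fun s => s.1 x, map_zero' := rfl, map_add' := fun _ _ => rfl }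
  exact map_sum ev _ _

theorem comapₗ_toOpenₗ (f : M →ₗ[R] R) (U : TopologicalSpace.Opens (PrimeSpectrum.Top R)) (m : M) :
    comapₗ f U U subset_rfl (toOpenₗ R M U m) = toOpenₗ R R U (f m) := by
  rw [toOpenₗ_eq_const, toOpenₗ_eq_const]
  exact (comapₗ_const ..).trans (by simp)

open TopologicalSpace in
theorem exists_basis_sections
    {ι : Type*} [Fintype ι] (b : Module.Basis ι R M) (U : Opens (PrimeSpectrum.Top R)) :
    ∃ b' : Module.Basis ι ((structureSheafInType R R).obj.obj (.op U))
      ((structureSheafInType R M).obj.obj (.op U)), ∀ i, b' i = toOpenₗ R M U (b i) := by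
  classical
  let c (i : ι) : (structureSheafInType R M).obj.obj (.op U)
      →ₗ[(structureSheafInType R R).obj.obj (.op U)] (structureSheafInType R R).obj.obj (.op U) :=
    { toFun := comapₗ (b.coord i) U U subset_rfl
      map_add' := fun _ _ => map_add _ _ _
      map_smul' := fun r s => comapₗ_smul_section _ U r s }
  have hc (i j) : c i (toOpenₗ R M U (b j)) = if i = j then 1 else 0 := by
    refine (comapₗ_toOpenₗ (b.coord i) U (b j)).trans ?_
    rw [b.coord_apply, b.repr_self, Finsupp.single_apply]
    by_cases h : i = j
    · rw [if_pos h, if_pos h.symm, toOpenₗ_eq_const]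
      exact const_one U
    · rw [if_neg h, if_neg (Ne.symm h)]
      exact LinearMap.map_zero _
  have hli : LinearIndependent ((structureSheafInType R R).obj.obj (.op U))
      fun i => toOpenₗ R M U (b i) := by
    rw [Fintype.linearIndependent_iff]
    intro g hg i
    have := congrArg (c i) hg
    simpa [map_sum, hc] using this
  have hsp : ⊤ ≤ Submodule.span ((structureSheafInType R R).obj.obj (.op U))
      (Set.range fun i => toOpenₗ R M U (b i)) := by
    intro s _
    rw [← sum_comapₗ_coord_smul b U s]
    exact Submodule.sum_mem _ fun i _ => Submodule.smul_mem _ _ (Submodule.subset_span ⟨i, rfl⟩)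
  exact ⟨Module.Basis.mk hli hsp, fun i => Module.Basis.mk_apply hli hsp i⟩

end AlgebraicGeometry.StructureSheaf

namespace GKZ

theorem exists_basis_sections {N d : ℕ} {w : Fin N → ℕ} {ι : Type*} [Fintype ι]
    (b : Module.Basis ι (BaseRing d w) (Ftw d w)) (U : (Base d w).Opens) :
    ∃ b' : Module.Basis ι Γ(Base d w, U) Γ(FtwSheaf d w, U),
      ∀ i, b' i = toSection d w U (b i) :=
  StructureSheaf.exists_basis_sections b U

end GKZ

noncomputable section

namespace GKZ

open Polynomial

/-! ### Normal form of differential operators -/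

section Operators

variable {N : ℕ} {d : ℕ} {w : Fin N → ℕ}

theorem discr_ne_zero : discr d w ≠ 0 := by
  refine mul_ne_zero (MvPolynomial.X_ne_zero _) fun h => ?_
  have := congrArg (MvPolynomial.eval fun _ => conifold d w + 1) h
  simp at this

instance : IsDomain (BaseRing d w) :=
  IsLocalization.isDomain_localization (M := Submonoid.powers (discr d w))
    (powers_le_nonZeroDivisors_of_noZeroDivisors discr_ne_zero)

theorem algebraMap_injective :
    Function.Injective (algebraMap (MvPolynomial (Fin 3) ℂ) (BaseRing d w)) :=
  IsLocalization.injective (M := Submonoid.powers (discr d w)) _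
    (powers_le_nonZeroDivisors_of_noZeroDivisors discr_ne_zero)

instance : CharZero (BaseRing d w) :=
  charZero_of_injective_algebraMap (algebraMap ℂ (BaseRing d w)).injective

theorem coord_ne_zero (i : Fin 3) : coord d w i ≠ 0 := by
  unfold coord
  rw [Ne, map_eq_zero_iff _ algebraMap_injective]
  exact MvPolynomial.X_ne_zero _

theorem isUnit_v_mul : IsUnit (v d w * (v d w - algebraMap ℂ _ (conifold d w))) := by
  have := IsLocalization.Away.algebraMap_isUnit (S := BaseRing d w) (discr d w)
  rw [discr, map_mul, map_sub, MvPolynomial.C_eq_algebraMap,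
    ← IsScalarTower.algebraMap_apply ℂ (MvPolynomial (Fin 3) ℂ) (BaseRing d w)] at this
  exact this

theorem isUnit_v : IsUnit (v d w) := isUnit_of_mul_isUnit_left isUnit_v_mul

/-- The element is `d^d (v - v_c)`. -/
theorem isUnit_discriminant (hd : d ≠ 0) :
    IsUnit ((d : BaseRing d w) ^ d * v d w - ∏ i, (w i : BaseRing d w) ^ w i) := by
  have h1 : IsUnit (v d w - algebraMap ℂ _ (conifold d w)) :=
    isUnit_of_mul_isUnit_right isUnit_v_mul
  have h2 : IsUnit (algebraMap ℂ (BaseRing d w) ((d : ℂ) ^ d)) :=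
    (IsUnit.mk0 _ (pow_ne_zero _ (Nat.cast_ne_zero.2 hd))).map _
  have := h2.mul h1
  rw [mul_sub, ← map_mul, conifold,
    mul_inv_cancel_left₀ (pow_ne_zero _ (Nat.cast_ne_zero.2 hd))] at this
  simpa using this

theorem zDv_mul_ofFun (f : BaseRing d w) :
    zDv d w * ofFun d w f = ofFun d w f * zDv d w + ofFun d w (z d w * Dv d w f) := by
  refine Subtype.ext (LinearMap.ext fun g => ?_)
  change z d w * Dv d w (f * g) = f * (z d w * Dv d w g) + z d w * Dv d w f * g
  rw [Derivation.leibniz, smul_eq_mul, smul_eq_mul]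
  ring

variable (d w) in
/-- The ring of functions killed by `D_v`. -/
def constants : Subring (BaseRing d w) where
  carrier := {f | Dv d w f = 0}
  mul_mem' {a b} ha hb := by
    change Dv d w (a * b) = 0
    rw [Derivation.leibniz, show Dv d w a = 0 from ha, show Dv d w b = 0 from hb, smul_zero,
      smul_zero, add_zero]
  one_mem' := (Dv d w).map_one_eq_zero
  add_mem' {a b} ha hb := by
    change Dv d w (a + b) = 0
    rw [map_add, show Dv d w a = 0 from ha, show Dv d w b = 0 from hb, add_zero]
  zero_mem' := map_zero _
  neg_mem' {a} ha := by
    change Dv d w (-a) = 0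
    rw [map_neg, show Dv d w a = 0 from ha, neg_zero]

theorem z_mem_constants : z d w ∈ constants d w := (Dv_coord d w 1).trans (if_neg (by decide))

theorem lam_mem_constants : lam d w ∈ constants d w := (Dv_coord d w 2).trans (if_neg (by decide))

theorem Dv_v : Dv d w (v d w) = v d w := (Dv_coord d w 0).trans (if_pos rfl)

variable (d w) in
/-- Polynomials whose coefficients are killed by `D_v`. -/
def constPoly : Subring (BaseRing d w)[X] :=
  (Polynomial.mapRingHom (constants d w).subtype).range

theorem X_mem_constPoly : (X : (BaseRing d w)[X]) ∈ constPoly d w := ⟨X, by simp⟩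

theorem C_mem_constPoly {f : BaseRing d w} (hf : f ∈ constants d w) : C f ∈ constPoly d w :=
  ⟨C ⟨f, hf⟩, by simp⟩

theorem coeff_mem_constants {q : (BaseRing d w)[X]} (hq : q ∈ constPoly d w) (k : ℕ) :
    q.coeff k ∈ constants d w := by
  obtain ⟨p, rfl⟩ := hq
  rw [coe_mapRingHom, coeff_map]
  exact (p.coeff k).2

/-- The differential operator `∑ f_k (z D_v)^k` attached to the polynomial `∑ f_k X^k`. -/
def op : (BaseRing d w)[X] →+ Rtw d w :=
  Polynomial.eval₂AddMonoidHom (ofFun d w : BaseRing d w →+* Rtw d w) (zDv d w)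

theorem op_apply (p : (BaseRing d w)[X]) :
    op p = p.eval₂ (ofFun d w : BaseRing d w →+* Rtw d w) (zDv d w) := rfl

@[simp]
theorem op_C (f : BaseRing d w) : op (C f) = ofFun d w f := by simp [op_apply]

@[simp]
theorem op_X : op (X : (BaseRing d w)[X]) = zDv d w := by simp [op_apply]

@[simp]
theorem op_one : op (1 : (BaseRing d w)[X]) = 1 := by simp [op_apply]

theorem op_C_mul (f : BaseRing d w) (p : (BaseRing d w)[X]) :
    op (C f * p) = ofFun d w f * op p := by
  rw [op_apply, op_apply, ← smul_eq_C_mul, eval₂_smul]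
  rfl

/-- Operators with coefficients killed by `D_v` commute with `z D_v`, so that multiplying by them on
the right is multiplying polynomials. -/
theorem op_mul (p : (BaseRing d w)[X]) {q : (BaseRing d w)[X]} (hq : q ∈ constPoly d w) :
    op (p * q) = op p * op q := by
  refine eval₂_mul_noncomm _ _ fun k => ?_
  change ofFun d w (q.coeff k) * zDv d w = zDv d w * ofFun d w (q.coeff k)
  rw [zDv_mul_ofFun, show Dv d w (q.coeff k) = 0 from coeff_mem_constants hq k, mul_zero, map_zero,
    add_zero]

theorem op_mul_v (q : (BaseRing d w)[X]) :
    op q * ofFun d w (v d w) = ofFun d w (v d w) * op (taylor (z d w) q) := by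
  induction q using Polynomial.induction_on' with
  | add p q hp hq => rw [map_add, map_add, map_add, add_mul, hp, hq, mul_add]
  | monomial k f =>
    have hc : X + C (z d w) ∈ constPoly d w :=
      add_mem X_mem_constPoly (C_mem_constPoly z_mem_constants)
    have h : op (X ^ k) * ofFun d w (v d w) =
        ofFun d w (v d w) * op ((X + C (z d w)) ^ k) := by
      induction k with
      | zero => simp
      | succ k ih =>
        rw [pow_succ', op_mul _ (pow_mem X_mem_constPoly k), mul_assoc, ih, ← mul_assoc, op_X,
          zDv_mul_ofFun, Dv_v, pow_succ', op_mul _ (pow_mem hc k), map_add, op_X, op_C, ← mul_assoc,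
          mul_add, ← map_mul, mul_comm (z d w)]
    rw [← C_mul_X_pow_eq_monomial, op_C_mul, taylor_mul, taylor_C, taylor_X_pow, op_C_mul,
      mul_assoc, h, ← mul_assoc, ← mul_assoc, ← map_mul, ← map_mul, mul_comm f]

variable (d w) in
/-- The inverse of the coordinate `v`. -/
def vInv : BaseRing d w := ↑(isUnit_v (d := d) (w := w)).unit⁻¹

theorem v_mul_vInv : v d w * vInv d w = 1 := IsUnit.mul_val_inv _

theorem vInv_mul_v : vInv d w * v d w = 1 := IsUnit.val_inv_mul _

theorem op_mul_vInv (q : (BaseRing d w)[X]) :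
    op q * ofFun d w (vInv d w) = ofFun d w (vInv d w) * op (taylor (-z d w) q) := by
  have h := op_mul_v (taylor (-z d w) q)
  rw [taylor_taylor, add_neg_cancel, taylor_zero] at h
  have h2 := congrArg (fun x => ofFun d w (vInv d w) * x * ofFun d w (vInv d w)) h
  simp only [mul_assoc, ← map_mul, v_mul_vInv, map_one, mul_one] at h2
  rw [← mul_assoc (ofFun d w (vInv d w)) (ofFun d w (v d w)), ← map_mul, vInv_mul_v, map_one,
    one_mul] at h2
  exact h2.symm

/-- On `v^n`, the operator `z D_v` acts as multiplication by `n z`. -/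
theorem op_apply_v_pow (p : (BaseRing d w)[X]) (n : ℕ) :
    (op p).1 (v d w ^ n) = p.eval (n * z d w) * v d w ^ n := by
  induction p using Polynomial.induction_on' with
  | add p q hp hq =>
    rw [map_add, eval_add, add_mul, ← hp, ← hq]
    rfl
  | monomial k f =>
    have h : (op (X ^ k) : Rtw d w).1 (v d w ^ n) = (n * z d w) ^ k * v d w ^ n := by
      induction k with
      | zero => simp; rfl
      | succ k ih =>
        rw [pow_succ', op_mul _ (pow_mem X_mem_constPoly k), op_X]
        change z d w * Dv d w ((op (X ^ k) : Rtw d w).1 (v d w ^ n)) = _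
        have h0 : Dv d w ((n * z d w) ^ k) = 0 :=
          (pow_mem (mul_mem (natCast_mem _ n) z_mem_constants) k : _ ∈ constants d w)
        rw [ih, Derivation.leibniz, h0, Derivation.leibniz_pow, Dv_v]
        rcases n with _ | n
        · simp
        · simp only [Nat.add_sub_cancel, smul_eq_mul, nsmul_eq_mul]
          ring
    rw [← C_mul_X_pow_eq_monomial, op_C_mul, eval_mul, eval_C, eval_pow, eval_X, mul_assoc, ← h]
    rfl

/-- An operator that is zero kills all `v^n`, so that its polynomial vanishes at the infinitely many
points `n z`. -/
theorem op_injective : Function.Injective (op : (BaseRing d w)[X] → Rtw d w) := by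
  refine (injective_iff_map_eq_zero _).2 fun p hp => ?_
  refine eq_zero_of_infinite_isRoot p (Set.infinite_of_injective_forall_mem
    (f := fun n : ℕ => (n : BaseRing d w) * z d w) (fun m n h => ?_) fun n => ?_)
  · exact Nat.cast_injective (mul_right_cancel₀ (coord_ne_zero 1) h)
  · have := op_apply_v_pow p n
    rw [hp] at this
    exact (mul_eq_zero.1 this.symm).resolve_right (pow_ne_zero _ (coord_ne_zero 0))

theorem exists_op_eq_zDv_mul (p : (BaseRing d w)[X]) : ∃ q, op q = zDv d w * op p := by
  induction p using Polynomial.induction_on' with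
  | add p q hp hq =>
    obtain ⟨p', hp⟩ := hp
    obtain ⟨q', hq⟩ := hq
    exact ⟨p' + q', by rw [map_add, map_add, mul_add, hp, hq]⟩
  | monomial k f =>
    refine ⟨(C f * X + C (z d w * Dv d w f)) * X ^ k, ?_⟩
    rw [op_mul _ (pow_mem X_mem_constPoly k), ← C_mul_X_pow_eq_monomial, op_C_mul, ← mul_assoc,
      zDv_mul_ofFun, map_add, op_C_mul, op_X, op_C]

theorem op_surjective : Function.Surjective (op : (BaseRing d w)[X] → Rtw d w) := by
  suffices h : ∀ r : Rtw d w, ∀ p, ∃ q, op q = r * op p from fun r => by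
    simpa using h r 1
  rintro ⟨r, hr⟩
  induction hr using Algebra.adjoin_induction with
  | mem r hr =>
    intro p
    rcases hr with ⟨f, rfl⟩ | rfl
    · exact ⟨C f * p, op_C_mul f p⟩
    · exact exists_op_eq_zDv_mul p
  | algebraMap c =>
    intro p
    refine ⟨C (algebraMap _ _ c) * p, ?_⟩
    rw [op_C_mul, AlgHom.commutes]
    rfl
  | add r s hr hs ihr ihs =>
    intro p
    obtain ⟨p', hp⟩ := ihr p
    obtain ⟨q', hq⟩ := ihs p
    refine ⟨p' + q', ?_⟩
    rw [map_add, hp, hq]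
    exact (add_mul (⟨r, hr⟩ : Rtw d w) ⟨s, hs⟩ (op p)).symm
  | mul r s hr hs ihr ihs =>
    intro p
    obtain ⟨p', hp⟩ := ihs p
    obtain ⟨q', hq⟩ := ihr p'
    refine ⟨q', ?_⟩
    rw [hq, hp]
    exact (mul_assoc (⟨r, hr⟩ : Rtw d w) ⟨s, hs⟩ (op p)).symm

end Operators

/-! ### The index set and the age -/

section Lattice

variable {N : ℕ} {d : ℕ} {w : Fin N → ℕ}

variable (d w) in
/-- The vector `ν(l)`, for an arbitrary integer `l`. -/
def nuInt (l : ℤ) : Fin (N + 1) → ℤ := Fin.cons l fun i => -⌊q d w i * (l : ℚ)⌋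

theorem nuInt_natCast (l : ℕ) : nuInt d w l = nuVec d w l := by simp [nuInt, nuVec]

theorem nuInt_mem (l : ℤ) : nuInt d w l ∈ B d w := by
  intro i
  have h := Int.floor_le (q d w i * (l : ℚ))
  simp only [nuInt, Fin.cons_zero, Fin.cons_succ, Int.cast_neg]
  linarith

variable (d w) in
/-- The increment of `⌊q_i l⌋` from `l` to `l + 1`. -/
def jump (l : ℤ) (i : Fin N) : ℕ := (⌊q d w i * ((l + 1 : ℤ) : ℚ)⌋ - ⌊q d w i * (l : ℚ)⌋).toNat

theorem floor_succ (l : ℤ) (i : Fin N) :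
    ⌊q d w i * ((l + 1 : ℤ) : ℚ)⌋ = ⌊q d w i * (l : ℚ)⌋ + jump d w l i := by
  have : ⌊q d w i * (l : ℚ)⌋ ≤ ⌊q d w i * ((l + 1 : ℤ) : ℚ)⌋ :=
    Int.floor_le_floor (mul_le_mul_of_nonneg_left (by push_cast; linarith) (q_nonneg d w i))
  rw [jump, Int.toNat_of_nonneg (by omega)]
  ring

theorem floor_add_degree (hd : d ≠ 0) (l : ℤ) (i : Fin N) :
    ⌊q d w i * ((l + d : ℤ) : ℚ)⌋ = ⌊q d w i * (l : ℚ)⌋ + w i := by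
  have : q d w i * ((l + d : ℤ) : ℚ) = q d w i * (l : ℚ) + (w i : ℤ) := by
    have : (d : ℚ) ≠ 0 := Nat.cast_ne_zero.2 hd
    unfold q
    push_cast
    field_simp
  rw [this, Int.floor_add_intCast]

theorem floor_add_natCast (l : ℤ) (n : ℕ) (i : Fin N) :
    ⌊q d w i * ((l + n : ℤ) : ℚ)⌋ =
      ⌊q d w i * (l : ℚ)⌋ + (∑ j ∈ Finset.range n, jump d w (l + j) i : ℕ) := by
  induction n with
  | zero => simp
  | succ n ih =>
    rw [Finset.sum_range_succ, Nat.cast_add (∑ j ∈ Finset.range n, jump d w (l + j) i), ← add_assoc,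
      ← ih, ← floor_succ, Nat.cast_succ, add_assoc]

theorem sum_jump (hd : d ≠ 0) (l : ℤ) (i : Fin N) :
    ∑ j ∈ Finset.range d, jump d w (l + j) i = w i := by
  have h1 := floor_add_natCast (d := d) (w := w) l d i
  have h2 := floor_add_degree (w := w) hd l i
  omega

variable (d w) in
/-- The age `l - ∑ ⌊q_i l⌋ = ∑ {q_i l}` of `l`, where `{·}` is the fractional part. -/
def age (l : ℤ) : ℕ := (l - ∑ i, ⌊q d w i * (l : ℚ)⌋).toNat

theorem sum_q (hd : d ≠ 0) (hCY : d = ∑ j, w j) : ∑ i, q d w i = 1 := by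
  unfold q
  rw [← Finset.sum_div, ← Nat.cast_sum, ← hCY, div_self (Nat.cast_ne_zero.2 hd)]

theorem natCast_age (hd : d ≠ 0) (hCY : d = ∑ j, w j) (l : ℤ) :
    (age d w l : ℤ) = l - ∑ i, ⌊q d w i * (l : ℚ)⌋ := by
  refine Int.toNat_of_nonneg ?_
  have h : (∑ i, ⌊q d w i * (l : ℚ)⌋ : ℚ) ≤ ∑ i, q d w i * (l : ℚ) :=
    Finset.sum_le_sum fun i _ => Int.floor_le _
  rw [← Finset.sum_mul, sum_q hd hCY, one_mul] at h
  have h' : ∑ i, ⌊q d w i * (l : ℚ)⌋ ≤ l := by exact_mod_cast h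
  omega

/-- The age increases by one, less the order of the operator `stepPoly`. -/
theorem age_succ (hd : d ≠ 0) (hCY : d = ∑ j, w j) (l : ℤ) :
    age d w (l + 1) + ∑ i, jump d w l i = age d w l + 1 := by
  have h1 := natCast_age hd hCY l
  have h2 := natCast_age hd hCY (l + 1)
  have h3 : ∑ i, ⌊q d w i * ((l + 1 : ℤ) : ℚ)⌋ =
      ∑ i, ⌊q d w i * (l : ℚ)⌋ + ((∑ i, jump d w l i : ℕ) : ℤ) := by
    rw [Nat.cast_sum, ← Finset.sum_add_distrib]
    exact Finset.sum_congr rfl fun i _ => floor_succ l i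
  omega

theorem age_add_degree (hd : d ≠ 0) (hCY : d = ∑ j, w j) (l : ℤ) :
    age d w (l + d) = age d w l := by
  have h1 := natCast_age hd hCY l
  have h2 := natCast_age hd hCY (l + d)
  have h3 : ∑ i, ⌊q d w i * ((l + d : ℤ) : ℚ)⌋ =
      ∑ i, ⌊q d w i * (l : ℚ)⌋ + d := by
    rw [Finset.sum_congr rfl fun i _ => floor_add_degree hd l i, Finset.sum_add_distrib,
      ← Nat.cast_sum, ← hCY]
  omega

theorem nuInt_add_relVec (hd : d ≠ 0) (l : ℤ) : nuInt d w (l + d) + relVec d w = nuInt d w l := by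
  funext i
  refine Fin.cases ?_ (fun i => ?_) i
  · simp [nuInt, relVec]
  · have := floor_add_degree (w := w) hd l i
    simp only [nuInt, relVec, Pi.add_apply, Fin.cons_succ]
    omega

/-- A vector of natural numbers, seen in `ℤ^{N+1}` with zeroth entry `0`. -/
def tailVec (k : Fin N → ℕ) : Fin (N + 1) → ℤ := Fin.cons 0 fun i => (k i : ℤ)

/-- Both sides index the two expressions for `Δ_{ν(l) + e_0}`. -/
theorem nuInt_add_single (l : ℤ) :
    nuInt d w l + Pi.single 0 1 = nuInt d w (l + 1) + tailVec (jump d w l) := by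
  funext i
  refine Fin.cases ?_ (fun i => ?_) i
  · simp [nuInt, tailVec]
  · have := floor_succ (d := d) (w := w) l i
    simp only [nuInt, tailVec, Pi.add_apply, Fin.cons_succ, Pi.single_apply, Fin.succ_ne_zero,
      if_false]
    omega

variable (d w) in
/-- The vector `k` with `ν = ν(ν_0) + (0, k)`. -/
def excess (ν : Fin (N + 1) → ℤ) (i : Fin N) : ℕ := (ν i.succ + ⌊q d w i * (ν 0 : ℚ)⌋).toNat

theorem natCast_excess {ν : Fin (N + 1) → ℤ} (hν : ν ∈ B d w) (i : Fin N) :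
    (excess d w ν i : ℤ) = ν i.succ + ⌊q d w i * (ν 0 : ℚ)⌋ := by
  refine Int.toNat_of_nonneg ?_
  have h := hν i
  have : (-(ν i.succ) : ℤ) ≤ ⌊q d w i * (ν 0 : ℚ)⌋ := by
    rw [Int.le_floor]
    push_cast
    linarith
  omega

/-- Modulo the directions `e_1, …, e_N`, an element of `B` is determined by its zeroth entry. -/
theorem eq_nuInt_add_tailVec {ν : Fin (N + 1) → ℤ} (hν : ν ∈ B d w) :
    ν = nuInt d w (ν 0) + tailVec (excess d w ν) := by
  funext i
  refine Fin.cases ?_ (fun i => ?_) i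
  · simp [nuInt, tailVec]
  · have := natCast_excess hν i
    simp only [nuInt, tailVec, Pi.add_apply, Fin.cons_succ]
    omega

end Lattice

/-! ### The operators between the generators, as polynomials -/

section Polynomials

variable {N : ℕ} {d : ℕ} {w : Fin N → ℕ}

variable (d w) in
/-- The polynomial of the operator `d z D_v + λ + (l + 1) z`. -/
def zerothPoly (l : ℤ) : (BaseRing d w)[X] :=
  C (d : BaseRing d w) * X + C (lam d w + ((l + 1 : ℤ) : BaseRing d w) * z d w)

variable (d w) in
/-- The polynomial of the operator `w_i z D_v - m z`. -/
def linPoly (i : Fin N) (m : ℤ) : (BaseRing d w)[X] :=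
  C (w i : BaseRing d w) * X - C ((m : BaseRing d w) * z d w)

variable (d w) in
/-- The polynomial of the operator that takes `Δ_ν` to `Δ_{ν + (0, k)}`. -/
def prodPoly (ν : Fin (N + 1) → ℤ) (k : Fin N → ℕ) : (BaseRing d w)[X] :=
  ∏ i, ∏ j ∈ Finset.range (k i), linPoly d w i (ν i.succ + j)

theorem zerothPoly_mem (l : ℤ) : zerothPoly d w l ∈ constPoly d w :=
  add_mem (mul_mem (C_mem_constPoly (natCast_mem _ _)) X_mem_constPoly)
    (C_mem_constPoly (add_mem lam_mem_constants (mul_mem (intCast_mem _ _) z_mem_constants)))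

theorem linPoly_mem (i : Fin N) (m : ℤ) : linPoly d w i m ∈ constPoly d w :=
  sub_mem (mul_mem (C_mem_constPoly (natCast_mem _ _)) X_mem_constPoly)
    (C_mem_constPoly (mul_mem (intCast_mem _ _) z_mem_constants))

theorem prodPoly_mem (ν : Fin (N + 1) → ℤ) (k : Fin N → ℕ) : prodPoly d w ν k ∈ constPoly d w :=
  prod_mem fun i _ => prod_mem fun _ _ => linPoly_mem i _

theorem zerothPoly_natDegree_le (l : ℤ) : (zerothPoly d w l).natDegree ≤ 1 := by
  unfold zerothPoly
  compute_degree

theorem zerothPoly_coeff_one (l : ℤ) : (zerothPoly d w l).coeff 1 = d := by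
  rw [zerothPoly, coeff_add, coeff_C_mul, coeff_X_one, coeff_C_succ, mul_one, add_zero]

theorem op_zerothPoly (l : ℤ) : op (zerothPoly d w l) = (d : Rtw d w) * zDv d w +
    ofFun d w (lam d w) + ((l + 1 : ℤ) : Rtw d w) * ofFun d w (z d w) := by
  rw [zerothPoly, map_add, op_C_mul, op_C, op_X, map_add, map_mul, map_natCast, map_intCast,
    add_assoc]

theorem op_linPoly (i : Fin N) (m : ℤ) : op (linPoly d w i m) =
    (w i : Rtw d w) * zDv d w - (m : Rtw d w) * ofFun d w (z d w) := by
  rw [linPoly, map_sub, op_C_mul, op_C, op_X, map_mul, map_natCast, map_intCast]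

@[simp]
theorem prodPoly_zero (ν : Fin (N + 1) → ℤ) : prodPoly d w ν 0 = 1 := by simp [prodPoly]

theorem prodPoly_add_single (ν : Fin (N + 1) → ℤ) (k : Fin N → ℕ) (i : Fin N) :
    prodPoly d w ν (k + Pi.single i 1) = linPoly d w i (ν i.succ + k i) * prodPoly d w ν k := by
  have h : ∀ i', ∏ j ∈ Finset.range ((k + Pi.single i 1 : Fin N → ℕ) i'),
      linPoly d w i' (ν i'.succ + j) =
      (if i' = i then linPoly d w i (ν i.succ + k i) else 1) *
        ∏ j ∈ Finset.range (k i'), linPoly d w i' (ν i'.succ + j) := by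
    intro i'
    by_cases hi : i' = i
    · subst hi
      simp [Finset.prod_range_succ, mul_comm]
    · simp [hi]
  rw [prodPoly, Finset.prod_congr rfl fun i' _ => h i', Finset.prod_mul_distrib,
    Finset.prod_ite_eq' Finset.univ i, if_pos (Finset.mem_univ i), prodPoly]

theorem prodPoly_add (ν : Fin (N + 1) → ℤ) (k k' : Fin N → ℕ) :
    prodPoly d w ν (k + k') = prodPoly d w (ν + tailVec k) k' * prodPoly d w ν k := by
  rw [prodPoly, prodPoly, prodPoly, ← Finset.prod_mul_distrib]
  refine Finset.prod_congr rfl fun i _ => ?_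
  rw [Pi.add_apply, Finset.prod_range_add, mul_comm]
  congr 1
  refine Finset.prod_congr rfl fun j _ => ?_
  simp [tailVec, add_assoc]

/-- Induction on vectors of natural numbers, one unit step at a time. -/
theorem tuple_induction {P : (Fin N → ℕ) → Prop} (h0 : P 0)
    (hs : ∀ k i, P k → P (k + Pi.single i 1)) (k : Fin N → ℕ) : P k := by
  obtain ⟨n, hn⟩ : ∃ n, ∑ i, k i = n := ⟨_, rfl⟩
  induction n generalizing k with
  | zero =>
    have : k = 0 := funext fun i => Finset.sum_eq_zero_iff.1 hn i (Finset.mem_univ i)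
    rwa [this]
  | succ n ih =>
    obtain ⟨i, -, hi⟩ := Finset.exists_ne_zero_of_sum_ne_zero (show ∑ i, k i ≠ 0 by omega)
    have hk : k - Pi.single i 1 + Pi.single i 1 = k := by
      refine tsub_add_cancel_of_le fun i' => ?_
      by_cases h : i' = i
      · subst h
        simp only [Pi.single_eq_same]
        omega
      · simp [h]
    rw [← hk]
    refine hs _ _ (ih _ ?_)
    rw [← hk] at hn
    simp only [Pi.add_apply, Finset.sum_add_distrib, Finset.sum_pi_single',
      Finset.mem_univ, if_true] at hn
    omega

theorem linPoly_natDegree_le (i : Fin N) (m : ℤ) : (linPoly d w i m).natDegree ≤ 1 := by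
  unfold linPoly
  compute_degree

theorem linPoly_coeff_one (i : Fin N) (m : ℤ) : (linPoly d w i m).coeff 1 = w i := by
  rw [linPoly, coeff_sub, coeff_C_mul, coeff_X_one, coeff_C_succ, mul_one, sub_zero]

theorem prodPoly_natDegree_le (ν : Fin (N + 1) → ℤ) (k : Fin N → ℕ) :
    (prodPoly d w ν k).natDegree ≤ ∑ i, k i := by
  refine (natDegree_prod_le _ _).trans (Finset.sum_le_sum fun i _ => ?_)
  refine (natDegree_prod_le _ _).trans ?_
  refine (Finset.sum_le_sum fun j _ => linPoly_natDegree_le i _).trans ?_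
  simp

/-- The coefficient in the top degree allowed by `prodPoly_natDegree_le`. -/
theorem prodPoly_coeff_sum (ν : Fin (N + 1) → ℤ) (k : Fin N → ℕ) :
    (prodPoly d w ν k).coeff (∑ i, k i) = ∏ i, (w i : BaseRing d w) ^ k i := by
  induction k using tuple_induction with
  | h0 => simp
  | hs k i ih =>
    have h1 : ∑ i', (k + Pi.single i 1 : Fin N → ℕ) i' = 1 + ∑ i', k i' := by
      simp [Finset.sum_add_distrib, add_comm]
    rw [h1, prodPoly_add_single,
      coeff_mul_add_eq_of_natDegree_le (linPoly_natDegree_le i _) (prodPoly_natDegree_le ν k), ih]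
    simp only [Pi.add_apply, pow_add, Finset.prod_mul_distrib]
    rw [mul_comm]
    congr 1
    simp [linPoly_coeff_one, Pi.single_apply, pow_ite]

end Polynomials

/-! ### Leading coefficients of polynomials -/

section Degree

variable {A : Type*} [CommRing A]

theorem mem_degreeLT_iff_coeff {p : A[X]} {n : ℕ} :
    p ∈ degreeLT A n ↔ ∀ m, n ≤ m → p.coeff m = 0 := by
  rw [mem_degreeLT, degree_lt_iff_coeff_zero]

theorem eq_zero_of_mem_degreeLT_zero {p : A[X]} (hp : p ∈ degreeLT A 0) : p = 0 :=
  Polynomial.ext fun m => mem_degreeLT_iff_coeff.1 hp m m.zero_le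

theorem mem_degreeLT_succ_iff {p : A[X]} {n : ℕ} : p ∈ degreeLT A (n + 1) ↔ p.natDegree ≤ n := by
  rw [mem_degreeLT_iff_coeff, natDegree_le_iff_coeff_eq_zero]
  rfl

theorem sub_monomial_mem_degreeLT {p : A[X]} {n : ℕ} {c : A} (hp : p.natDegree ≤ n)
    (hc : p.coeff n = c) : p - C c * X ^ n ∈ degreeLT A n := by
  rw [mem_degreeLT_iff_coeff]
  intro m hm
  rw [coeff_sub, coeff_C_mul_X_pow]
  rcases hm.eq_or_lt with rfl | hm
  · rw [if_pos rfl, hc, sub_self]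
  · rw [if_neg hm.ne', coeff_eq_zero_of_natDegree_lt (hp.trans_lt hm), sub_zero]

end Degree

/-! ### The generators indexed by the integers -/

section Relations

variable {N : ℕ} {d : ℕ} {w : Fin N → ℕ}

theorem smul_Ftw (f : BaseRing d w) (x : Ftw d w) : f • x = ofFun d w f • x := rfl

theorem Delta_eq_of_isRelation {r : Rtw d w} {ν μ : B d w}
    (h : IsRelation d w (r • symbol d w ν - symbol d w μ)) : Delta d w μ = r • Delta d w ν := by
  have h1 : Submodule.Quotient.mk (p := Submodule.span (Rtw d w) {x | IsRelation d w x})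
      (r • symbol d w ν - symbol d w μ) = 0 :=
    (Submodule.Quotient.mk_eq_zero _).2 (Submodule.subset_span h)
  rw [Submodule.Quotient.mk_sub, Submodule.Quotient.mk_smul] at h1
  exact (sub_eq_zero.1 h1).symm

theorem Delta_add_single_zero {ν μ : B d w} (h : μ.1 = ν.1 + Pi.single 0 1) :
    Delta d w μ = op (zerothPoly d w (ν.1 0)) • Delta d w ν := by
  obtain rfl : μ = ⟨ν.1 + Pi.single 0 1, add_single_mem d w ν.2 0⟩ := Subtype.ext h
  rw [op_zerothPoly]
  exact Delta_eq_of_isRelation (.zeroth ν)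

theorem Delta_add_single_succ {ν μ : B d w} {i : Fin N} (h : μ.1 = ν.1 + Pi.single i.succ 1) :
    Delta d w μ = op (linPoly d w i (ν.1 i.succ)) • Delta d w ν := by
  obtain rfl : μ = ⟨ν.1 + Pi.single i.succ 1, add_single_mem d w ν.2 i.succ⟩ := Subtype.ext h
  rw [op_linPoly]
  exact Delta_eq_of_isRelation (.succ ν i)

theorem Delta_add_relVec {ν μ : B d w} (h : μ.1 = ν.1 + relVec d w) :
    Delta d w μ = v d w • Delta d w ν := by
  obtain rfl : μ = ⟨ν.1 + relVec d w, add_relVec_mem d w ν.2⟩ := Subtype.ext h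
  exact Delta_eq_of_isRelation (.mulv ν)

theorem tailVec_add_single (k : Fin N → ℕ) (i : Fin N) :
    tailVec (k + Pi.single i 1) = tailVec k + Pi.single i.succ 1 := by
  funext i'
  refine Fin.cases ?_ (fun i' => ?_) i'
  · simp [tailVec, Pi.single_apply, (Fin.succ_ne_zero i).symm]
  · by_cases h : i' = i <;> simp [tailVec, Pi.single_apply, h]

theorem add_tailVec_mem {ν : Fin (N + 1) → ℤ} (hν : ν ∈ B d w) (k : Fin N → ℕ) :
    ν + tailVec k ∈ B d w := by
  intro i
  have h := hν i
  have : (0 : ℚ) ≤ k i := Nat.cast_nonneg _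
  simp only [tailVec, Pi.add_apply, Fin.cons_succ, Fin.cons_zero, add_zero, Int.cast_add,
    Int.cast_natCast]
  linarith

theorem Delta_add_tailVec {ν : B d w} (k : Fin N → ℕ) {μ : B d w} (h : μ.1 = ν.1 + tailVec k) :
    Delta d w μ = op (prodPoly d w ν.1 k) • Delta d w ν := by
  induction k using tuple_induction generalizing μ with
  | h0 =>
    have : μ = ν := Subtype.ext <| h.trans <| by
      funext i
      refine Fin.cases ?_ (fun i => ?_) i <;> simp [tailVec]
    rw [this, prodPoly_zero, op_one, one_smul]
  | hs k i ih =>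
    rw [tailVec_add_single, ← add_assoc] at h
    rw [Delta_add_single_succ (ν := ⟨ν.1 + tailVec k, add_tailVec_mem ν.2 k⟩) h, ih rfl, smul_smul,
      prodPoly_add_single, op_mul _ (prodPoly_mem _ _)]
    simp [tailVec]

variable (d w) in
/-- The element `Δ_{ν(l)}`, for an arbitrary integer `l`. -/
def DeltaInt (l : ℤ) : Ftw d w := Delta d w ⟨nuInt d w l, nuInt_mem l⟩

theorem DeltaInt_natCast (l : ℕ) : DeltaInt d w l = DeltaNu d w l :=
  congrArg (Delta d w) (Subtype.ext (nuInt_natCast l))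

variable (d w) in
/-- The polynomial of the operator that takes `Δ_{ν(l+1)}` to `Δ_{ν(l) + e_0}`. -/
def stepPoly (l : ℤ) : (BaseRing d w)[X] := prodPoly d w (nuInt d w (l + 1)) (jump d w l)

/-- The two expressions for `Δ_{ν(l) + e_0}`, in terms of `Δ_{ν(l)}` and of `Δ_{ν(l+1)}`. -/
theorem op_zerothPoly_smul_DeltaInt (l : ℤ) :
    op (zerothPoly d w l) • DeltaInt d w l = op (stepPoly d w l) • DeltaInt d w (l + 1) := by
  let μ : B d w := ⟨nuInt d w l + Pi.single 0 1, add_single_mem d w (nuInt_mem l) 0⟩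
  have h1 := Delta_add_single_zero (ν := ⟨nuInt d w l, nuInt_mem l⟩) (μ := μ) rfl
  have h2 := Delta_add_tailVec (ν := ⟨nuInt d w (l + 1), nuInt_mem _⟩) (jump d w l) (μ := μ)
    (nuInt_add_single l)
  exact h1.symm.trans h2

theorem v_smul_DeltaInt (hd : d ≠ 0) (l : ℤ) :
    v d w • DeltaInt d w (l + d) = DeltaInt d w l :=
  (Delta_add_relVec (nuInt_add_relVec hd l).symm).symm

theorem DeltaInt_add_degree (hd : d ≠ 0) (l : ℤ) :
    DeltaInt d w (l + d) = vInv d w • DeltaInt d w l := by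
  rw [← v_smul_DeltaInt hd l, smul_smul, vInv_mul_v, one_smul]

theorem Delta_eq_op_smul (ν : B d w) :
    Delta d w ν = op (prodPoly d w (nuInt d w (ν.1 0)) (excess d w ν.1)) • DeltaInt d w (ν.1 0) :=
  Delta_add_tailVec (ν := ⟨nuInt d w (ν.1 0), nuInt_mem _⟩) _ (eq_nuInt_add_tailVec ν.2)

/-- Every element of the module is a sum of elements `P Δ_{ν(l)}` with `P` a differential
operator. -/
theorem op_smul_induction {P : Ftw d w → Prop} (x : Ftw d w)
    (hadd : ∀ x y, P x → P y → P (x + y)) (hzero : P 0)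
    (hop : ∀ (p : (BaseRing d w)[X]) l, P (op p • DeltaInt d w l)) : P x := by
  obtain ⟨x, rfl⟩ := Submodule.Quotient.mk_surjective _ x
  induction x using Finsupp.induction_linear with
  | zero => exact hzero
  | add x y hx hy => exact hadd _ _ hx hy
  | single ν r =>
    have h : (Submodule.Quotient.mk (Finsupp.single ν r) : Ftw d w) = r • Delta d w ν := by
      rw [show Finsupp.single ν r = r • symbol d w ν by simp [symbol]]
      rfl
    obtain ⟨p, hp⟩ := op_surjective r
    change P (Submodule.Quotient.mk (Finsupp.single ν r) : Ftw d w)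
    rw [h, Delta_eq_op_smul, smul_smul, ← hp, ← op_mul _ (prodPoly_mem _ _)]
    exact hop _ _

end Relations

/-! ### Generation -/

section Generation

variable {N : ℕ} {d : ℕ} {w : Fin N → ℕ}

variable (d w) in
/-- The span over the functions of the `Δ_{ν(l)}` of age less than `k`. -/
def ageLT (k : ℕ) : Submodule (BaseRing d w) (Ftw d w) :=
  Submodule.span (BaseRing d w) (DeltaInt d w '' {l | age d w l < k})

theorem ageLT_mono {k k' : ℕ} (h : k ≤ k') : ageLT d w k ≤ ageLT d w k' :=
  Submodule.span_mono (Set.image_mono fun _ hl => lt_of_lt_of_le hl h)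

theorem op_C_mul_smul (f : BaseRing d w) (p : (BaseRing d w)[X]) (x : Ftw d w) :
    op (C f * p) • x = f • op p • x := by
  rw [op_C_mul, mul_smul, smul_Ftw]

/-- The product of the leading coefficients of the operators `stepPoly` over one period. -/
theorem prod_prod_jump (hd : d ≠ 0) (l : ℤ) :
    ∏ j ∈ Finset.range d, ∏ i, (w i : BaseRing d w) ^ jump d w (l + j) i =
      ∏ i, (w i : BaseRing d w) ^ w i := by
  rw [Finset.prod_comm]
  refine Finset.prod_congr rfl fun i _ => ?_
  rw [Finset.prod_pow_eq_pow_sum, sum_jump hd]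

/-- The induction step for generation: a leading term of degree exactly `k` is pushed along the
relations, modulo terms of smaller degree, which the hypothesis `ih` controls. -/
theorem op_smul_mem_ageLT_succ_of_forall (hd : d ≠ 0) (hCY : d = ∑ j, w j) {k : ℕ}
    (ih : ∀ l, ∀ p ∈ degreeLT (BaseRing d w) (k - age d w l),
      (op p : Rtw d w) • DeltaInt d w l ∈ ageLT d w k) (l : ℤ) (hl : age d w l ≤ k) :
    op (X ^ (k - age d w l) : (BaseRing d w)[X]) • DeltaInt d w l ∈ ageLT d w (k + 1) := by
  let π := (ageLT d w (k + 1)).mkQ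
  -- For `age l ≤ k`, `y l` is the class of the leading term of degree `k` at `l`.
  let y : ℤ → Ftw d w ⧸ ageLT d w (k + 1) := fun l =>
    π (op (X ^ (k - age d w l) : (BaseRing d w)[X]) • DeltaInt d w l)
  have hπ (p : (BaseRing d w)[X]) (c : BaseRing d w) (l : ℤ)
      (hdeg : p.natDegree ≤ k - age d w l) (hc : p.coeff (k - age d w l) = c) :
      π (op p • DeltaInt d w l) = c • y l := by
    have h := ageLT_mono k.le_succ (ih l _ (sub_monomial_mem_degreeLT hdeg hc))
    rw [map_sub, sub_smul, op_C_mul_smul] at h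
    rw [← map_smul]
    exact (Submodule.Quotient.eq _).2 h
  have hy0 (l : ℤ) (h : age d w l = k) : y l = 0 := by
    refine (Submodule.Quotient.mk_eq_zero _).2 ?_
    rw [h, Nat.sub_self, pow_zero, op_one, one_smul]
    exact Submodule.subset_span ⟨l, by simp [h], rfl⟩
  have hy1 (l : ℤ) (h : age d w l < k) :
      (d : BaseRing d w) • y l = (∏ i, (w i : BaseRing d w) ^ jump d w l i) • y (l + 1) := by
    have hs := age_succ hd hCY l
    have h1 : k - age d w l = (k - age d w l - 1) + 1 := by omega
    have h2 : k - age d w (l + 1) = (k - age d w l - 1) + ∑ i, jump d w l i := by omega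
    have hX : (X ^ (k - age d w l - 1) : (BaseRing d w)[X]).natDegree ≤ k - age d w l - 1 :=
      natDegree_X_pow_le _
    have hz : (zerothPoly d w l).natDegree ≤ 1 := zerothPoly_natDegree_le l
    rw [← hπ (X ^ (k - age d w l - 1) * zerothPoly d w l) (d : BaseRing d w) l
        (by rw [h1]; exact natDegree_mul_le_of_le hX hz)
        (by
          rw [h1, Nat.add_sub_cancel, coeff_mul_add_eq_of_natDegree_le (natDegree_X_pow_le _) hz,
            coeff_X_pow_self, one_mul, zerothPoly_coeff_one]),
      ← hπ (X ^ (k - age d w l - 1) * stepPoly d w l) _ (l + 1)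
        (by rw [h2]; exact natDegree_mul_le_of_le hX (prodPoly_natDegree_le _ _))
        (by
          rw [h2, stepPoly, coeff_mul_add_eq_of_natDegree_le hX (prodPoly_natDegree_le _ _),
            coeff_X_pow_self, one_mul, prodPoly_coeff_sum]),
      op_mul _ (zerothPoly_mem l), mul_smul, op_zerothPoly_smul_DeltaInt, smul_smul,
      ← op_mul _ (show stepPoly d w l ∈ constPoly d w from prodPoly_mem _ _)]
  have hyd (l : ℤ) : y (l + d) = vInv d w • y l := by
    have h : y (l + d) = vInv d w •
        π (op (taylor (-z d w) (X ^ (k - age d w l))) • DeltaInt d w l) := by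
      change π (op (X ^ (k - age d w (l + d)) : (BaseRing d w)[X]) • DeltaInt d w (l + d)) = _
      rw [age_add_degree hd hCY, DeltaInt_add_degree hd, smul_Ftw, smul_smul, op_mul_vInv, mul_smul,
        ← smul_Ftw, map_smul]
    -- The Taylor shift by `-z`, from moving `v⁻¹` to the left, does not change the leading term.
    rw [h, hπ _ 1 l, one_smul]
    · rw [natDegree_taylor]
      exact natDegree_X_pow_le _
    · have := coeff_taylor_natDegree (-z d w) (X ^ (k - age d w l) : (BaseRing d w)[X])
      rwa [natDegree_X_pow, (monic_X_pow _).leadingCoeff] at this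
  have hwalk (n : ℕ) (hn : ∀ j < n, age d w (l + j) < k) : (d : BaseRing d w) ^ n • y l =
      (∏ j ∈ Finset.range n, ∏ i, (w i : BaseRing d w) ^ jump d w (l + j) i) • y (l + n) := by
    induction n with
    | zero => simp
    | succ n ihn =>
      rw [pow_succ', mul_smul, ihn fun j hj => hn j (by omega), smul_comm, hy1 _ (hn n (by omega)),
        smul_smul, Finset.prod_range_succ, Nat.cast_succ, add_assoc]
  have hdu : IsUnit (d : BaseRing d w) := by
    have : IsUnit (algebraMap ℂ (BaseRing d w) d) :=
      (IsUnit.mk0 _ (Nat.cast_ne_zero.2 hd)).map _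
    simpa using this
  suffices h : y l = 0 from (Submodule.Quotient.mk_eq_zero _).1 h
  -- Either the walk from `l` reaches an index of age `k`, or it goes once round the cycle.
  by_cases h : ∃ n : ℕ, ¬ age d w (l + n) < k
  · classical
    have h1 := Nat.find_spec h
    have h2 : ∀ j < Nat.find h, age d w (l + j) < k := fun j hj => not_not.1 (Nat.find_min h hj)
    -- The age increases by at most one in each step, so it cannot jump over `k`.
    have h3 : age d w (l + Nat.find h) = k := by
      refine le_antisymm ?_ (not_lt.1 h1)
      rcases hn : Nat.find h with _ | n
      · simpa using hl
      · have h4 := h2 n (by omega)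
        have h5 := age_succ hd hCY (l + n)
        rw [Nat.cast_succ, ← add_assoc]
        omega
    have h4 := hwalk _ h2
    rw [hy0 _ h3, smul_zero] at h4
    exact (hdu.pow _).smul_eq_zero.1 h4
  · push Not at h
    have h1 := hwalk d fun j _ => h j
    rw [prod_prod_jump hd, hyd, smul_smul, ← sub_eq_zero, ← sub_smul] at h1
    refine (IsUnit.smul_eq_zero ?_).1 h1
    refine isUnit_of_mul_isUnit_left (y := v d w) ?_
    rw [sub_mul, mul_assoc, vInv_mul_v, mul_one]
    exact isUnit_discriminant hd

/-- An operator of order less than `k - age l` takes `Δ_{ν(l)}` into the span of the generators of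
age less than `k`. The truncated subtraction leaves only the operator `0` for `age l ≥ k`. -/
theorem op_smul_DeltaInt_mem_ageLT (hd : d ≠ 0) (hCY : d = ∑ j, w j) (k : ℕ) (l : ℤ)
    (p : (BaseRing d w)[X]) (hp : p ∈ degreeLT (BaseRing d w) (k - age d w l)) :
    op p • DeltaInt d w l ∈ ageLT d w k := by
  induction k generalizing l p with
  | zero =>
    rw [Nat.zero_sub] at hp
    rw [eq_zero_of_mem_degreeLT_zero hp, map_zero, zero_smul]
    exact Submodule.zero_mem _
  | succ k ih =>
    by_cases hl : age d w l ≤ k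
    · rw [Nat.succ_sub hl, mem_degreeLT_succ_iff] at hp
      have h1 := ageLT_mono k.le_succ (ih l _ (sub_monomial_mem_degreeLT hp rfl))
      rw [map_sub, sub_smul, op_C_mul_smul] at h1
      exact (Submodule.sub_mem_iff_left _ (Submodule.smul_mem _ _
        (op_smul_mem_ageLT_succ_of_forall hd hCY ih l hl))).1 h1
    · rw [Nat.sub_eq_zero_of_le (by omega)] at hp
      rw [eq_zero_of_mem_degreeLT_zero hp, map_zero, zero_smul]
      exact Submodule.zero_mem _

theorem DeltaInt_mem_span (hd : d ≠ 0) (l : ℤ) : DeltaInt d w l ∈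
    Submodule.span (BaseRing d w) (Set.range fun l : Fin d => DeltaNu d w l) := by
  set W := Submodule.span (BaseRing d w) (Set.range fun l : Fin d => DeltaNu d w l)
  have hd' : (0 : ℤ) < d := by omega
  have h0 : DeltaInt d w (l % d) ∈ W := by
    obtain ⟨m, hm⟩ := Int.eq_ofNat_of_zero_le (Int.emod_nonneg l hd'.ne')
    have := Int.emod_lt_of_pos l hd'
    rw [hm, DeltaInt_natCast]
    exact Submodule.subset_span ⟨⟨m, by omega⟩, rfl⟩
  have h (n : ℤ) : DeltaInt d w (l % d + d * n) ∈ W := by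
    induction n using Int.induction_on with
    | zero => simpa using h0
    | succ n ih =>
      rw [mul_add, mul_one, ← add_assoc, DeltaInt_add_degree hd]
      exact W.smul_mem _ ih
    | pred n ih =>
      rw [← v_smul_DeltaInt hd, mul_sub, mul_one, add_assoc, sub_add_cancel]
      exact W.smul_mem _ ih
  rw [← Int.emod_add_mul_ediv l d]
  exact h _

theorem span_DeltaNu (hd : d ≠ 0) (hCY : d = ∑ j, w j) :
    Submodule.span (BaseRing d w) (Set.range fun l : Fin d => DeltaNu d w l) = ⊤ := by
  refine eq_top_iff.2 fun x _ => ?_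
  refine op_smul_induction x (fun _ _ => Submodule.add_mem _) (Submodule.zero_mem _) fun p l => ?_
  have h := op_smul_DeltaInt_mem_ageLT hd hCY (p.natDegree + 1 + age d w l) l p
    (by rw [Nat.add_sub_cancel, mem_degreeLT_succ_iff])
  refine Submodule.span_le.2 ?_ h
  rintro _ ⟨l, -, rfl⟩
  exact DeltaInt_mem_span hd l

end Generation

/-! ### Cyclic systems of polynomial equations -/

section CyclicSystem

variable {A : Type*} [CommRing A]

theorem coeff_taylor_of_natDegree_le {q : A[X]} {n : ℕ} (hq : q.natDegree ≤ n) (γ : A) :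
    (taylor γ q).coeff n = q.coeff n := by
  rcases hq.eq_or_lt with rfl | h
  · rw [coeff_taylor_natDegree]
    rfl
  · rw [coeff_eq_zero_of_natDegree_lt h,
      coeff_eq_zero_of_natDegree_lt ((natDegree_taylor q γ).trans_lt h)]

/-- A property that passes from `m` to `m + 1` in `Fin d`, cyclically, holds everywhere if it holds
somewhere. -/
theorem forall_of_cyclic {d : ℕ} [NeZero d] {P : Fin d → Prop} (hs : ∀ m, P m → P (m + 1))
    {m₀ : Fin d} (h₀ : P m₀) (m : Fin d) : P m := by
  have h (n : ℕ) : P (m₀ + Fin.ofNat d n) := by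
    induction n with
    | zero => simpa using h₀
    | succ n ih =>
      have := hs _ ih
      rwa [add_assoc, show Fin.ofNat d n + 1 = Fin.ofNat d (n + 1) from by
        apply Fin.ext; simp [Fin.val_add]] at this
  have := h (m - m₀).val
  rwa [Fin.ofNat_val_eq_self, add_sub_cancel] at this

/-- A cyclic system of equations `p_{m+1} Z_{m+1} - u_m (p_m S_m)(X + γ_m) = const`, homogeneous to
leading order for the grading `a`, has only the solution `p = 0` if going round the cycle does not
preserve leading coefficients. -/
theorem eq_zero_of_cyclic_system [IsDomain A] {d : ℕ} [NeZero d] {a s : Fin d → ℕ}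
    (has : ∀ m, a (m + 1) + s m = a m + 1) {Z S : Fin d → A[X]} {δ u γ c : Fin d → A}
    (hZ : ∀ m, (Z m).natDegree ≤ 1) (hZc : ∀ m, (Z m).coeff 1 = δ m) (hδ : ∀ m, δ m ≠ 0)
    (hS : ∀ m, (S m).natDegree ≤ s m) (hSc : ∀ m, (S m).coeff (s m) = c m)
    (hprod : ∏ m, δ m ≠ ∏ m, u m * c m) {p : Fin d → A[X]} {f : Fin d → A}
    (h : ∀ m, C (f (m + 1)) = p (m + 1) * Z (m + 1) - C (u m) * taylor (γ m) (p m * S m)) :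
    p = 0 := by
  -- `K` bounds the degrees: the term `X^j` of `p m` has degree `j + a m`.
  suffices H : ∀ K, (∀ m, p m ∈ degreeLT A (K - a m)) → p = 0 by
    obtain ⟨K, hK⟩ : ∃ K, ∀ m, (p m).natDegree + 1 + a m ≤ K :=
      ⟨∑ m, ((p m).natDegree + 1 + a m), fun m =>
        Finset.single_le_sum (f := fun m => (p m).natDegree + 1 + a m) (fun _ _ => Nat.zero_le _)
          (Finset.mem_univ m)⟩
    refine H K fun m => degreeLT_mono (show (p m).natDegree + 1 ≤ _ from ?_)
      (mem_degreeLT_succ_iff.2 le_rfl)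
    have := hK m
    omega
  intro K
  induction K with
  | zero =>
    intro hp
    refine funext fun m => eq_zero_of_mem_degreeLT_zero ?_
    simpa using hp m
  | succ K ih =>
    intro hp
    have hp0 (m) (hm : K < a m) : p m = 0 := by
      have := hp m
      rw [Nat.sub_eq_zero_of_le (by omega)] at this
      exact eq_zero_of_mem_degreeLT_zero this
    have hp1 (m) (hm : a m ≤ K) : (p m).natDegree ≤ K - a m := by
      have := hp m
      rwa [Nat.succ_sub hm, mem_degreeLT_succ_iff] at this
    -- For `a m ≤ K`, the coefficient of the top degree `K`.
    let ρ : Fin d → A := fun m => (p m).coeff (K - a m)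
    have hρ0 (m) (hm : K < a m) : ρ m = 0 := by
      change (p m).coeff _ = 0
      rw [hp0 m hm, coeff_zero]
    have hρ (m) (hm : a (m + 1) ≤ K) : δ (m + 1) * ρ (m + 1) = u m * c m * ρ m := by
      have h1 := congrArg (fun q : A[X] => q.coeff (K - a (m + 1) + 1)) (h m)
      simp only [coeff_C_succ, coeff_sub, coeff_C_mul] at h1
      rw [coeff_mul_add_eq_of_natDegree_le (hp1 _ hm) (hZ _), hZc] at h1
      have h2 : (taylor (γ m) (p m * S m)).coeff (K - a (m + 1) + 1) = ρ m * c m := by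
        rcases le_or_gt (a m) K with hm' | hm'
        · have h3 := has m
          rw [show K - a (m + 1) + 1 = K - a m + s m by omega,
            coeff_taylor_of_natDegree_le (natDegree_mul_le_of_le (hp1 m hm') (hS m)),
            coeff_mul_add_eq_of_natDegree_le (hp1 m hm') (hS m), hSc]
        · rw [hρ0 m hm', hp0 m hm', zero_mul, zero_mul, map_zero, coeff_zero]
      rw [h2] at h1
      linear_combination -h1
    have hall : ∀ m, ρ m = 0 := by
      -- One zero propagates round the cycle; without zeros, the product of all equations `hρ`
      -- contradicts `hprod`.
      by_cases hex : ∃ m, ρ m = 0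
      · obtain ⟨m₀, hm₀⟩ := hex
        refine forall_of_cyclic (fun m hm => ?_) hm₀
        rcases le_or_gt (a (m + 1)) K with hm' | hm'
        · have := hρ m hm'
          rw [hm, mul_zero] at this
          exact (mul_eq_zero.1 this).resolve_left (hδ _)
        · exact hρ0 _ hm'
      · push Not at hex
        exfalso
        have h1 : ∏ m, δ (m + 1) * ρ (m + 1) = ∏ m, u m * c m * ρ m :=
          Finset.prod_congr rfl fun m _ => hρ m (not_lt.1 fun hm => hex _ (hρ0 _ hm))
        have hshift (g : Fin d → A) : ∏ m, g (m + 1) = ∏ m, g m :=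
          Equiv.prod_comp (Equiv.addRight (1 : Fin d)) g
        rw [Finset.prod_mul_distrib, Finset.prod_mul_distrib, hshift δ, hshift ρ] at h1
        exact hprod (mul_right_cancel₀ (Finset.prod_ne_zero_iff.2 fun m _ => hex m) h1)
    refine ih fun m => ?_
    rcases le_or_gt (a m) K with hm | hm
    · have := sub_monomial_mem_degreeLT (hp1 m hm) (hall m)
      rwa [map_zero, zero_mul, sub_zero] at this
    · rw [hp0 m hm]
      exact Submodule.zero_mem _

end CyclicSystem

/-! ### A model of the module -/

section Model

variable {N : ℕ} {d : ℕ} {w : Fin N → ℕ}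

theorem taylor_zerothPoly (l : ℤ) :
    taylor (z d w) (zerothPoly d w l) = zerothPoly d w (l + d) := by
  simp only [zerothPoly, map_add, taylor_mul, taylor_C, taylor_X, map_mul, Int.cast_add,
    Int.cast_natCast, Int.cast_one]
  ring

theorem taylor_linPoly (i : Fin N) (m : ℤ) :
    taylor (z d w) (linPoly d w i m) = linPoly d w i (m - w i) := by
  simp only [linPoly, map_sub, taylor_mul, taylor_C, taylor_X, map_mul, Int.cast_sub,
    Int.cast_natCast]
  ring

/-- The shift of the `ν_i` by `w_i` under `relVec` matches the shift of `z D_v` by `z` caused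
by `v`. -/
theorem taylor_prodPoly {ν μ : Fin (N + 1) → ℤ} (h : μ + relVec d w = ν) (k : Fin N → ℕ) :
    taylor (z d w) (prodPoly d w ν k) = prodPoly d w μ k := by
  subst h
  rw [prodPoly, prodPoly, ← taylorAlgHom_apply, map_prod]
  refine Finset.prod_congr rfl fun i _ => ?_
  rw [map_prod]
  refine Finset.prod_congr rfl fun j _ => ?_
  rw [taylorAlgHom_apply, taylor_linPoly]
  congr 1
  simp only [relVec, Pi.add_apply, Fin.cons_succ]
  ring

theorem prodPoly_congr {ν μ : Fin (N + 1) → ℤ} (h : ∀ i : Fin N, ν i.succ = μ i.succ)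
    (k : Fin N → ℕ) : prodPoly d w ν k = prodPoly d w μ k := by
  simp only [prodPoly, h]

theorem jump_add_degree (hd : d ≠ 0) (l : ℤ) : jump d w (l + d) = jump d w l := by
  funext i
  have h1 := floor_succ (d := d) (w := w) l i
  have h2 := floor_succ (d := d) (w := w) (l + d) i
  have h3 := floor_add_degree (w := w) hd l i
  have h4 := floor_add_degree (w := w) hd (l + 1) i
  rw [add_right_comm] at h2
  omega

theorem taylor_stepPoly (hd : d ≠ 0) (l : ℤ) :
    taylor (z d w) (stepPoly d w l) = stepPoly d w (l + d) := by
  rw [stepPoly, stepPoly, jump_add_degree hd, add_right_comm]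
  exact taylor_prodPoly (nuInt_add_relVec hd _) _

variable (d w) in
/-- Integer powers of the coordinate `v`. -/
def vPow (n : ℤ) : BaseRing d w := ↑((isUnit_v (d := d) (w := w)).unit ^ n)

theorem v_mul_vPow (n : ℤ) : v d w * vPow d w n = vPow d w (n + 1) := by
  rw [add_comm, vPow, vPow, zpow_add, zpow_one, Units.val_mul, IsUnit.unit_spec]

theorem vPow_zero : vPow d w 0 = 1 := by simp [vPow]

theorem vPow_neg_one : vPow d w (-1) = vInv d w := by simp [vPow, vInv]

variable [NeZero d]

/-- The residue of an integer modulo `d`. -/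
def residue (l : ℤ) : Fin d :=
  ⟨(l % d).toNat, by
    have := Int.emod_lt_of_pos l (show (0 : ℤ) < d from by exact_mod_cast Nat.pos_of_neZero d)
    have := Int.emod_nonneg l (show (d : ℤ) ≠ 0 from by exact_mod_cast NeZero.ne d)
    omega⟩

variable (d w) in
/-- The vector in `(R^tw)^d` that represents `Δ_{ν(l)}`: it is `v^{-⌊l / d⌋}` times the standard
basis vector of index `l mod d`. -/
def modelVec (l : ℤ) : Fin d → Rtw d w :=
  Pi.single (residue l) (ofFun d w (vPow d w (-(l / d))))

theorem v_smul_modelVec (l : ℤ) :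
    ofFun d w (v d w) • modelVec d w (l + d) = modelVec d w l := by
  have hd : (d : ℤ) ≠ 0 := by exact_mod_cast NeZero.ne d
  have h1 : (residue (l + d) : Fin d) = residue l := by simp [residue]
  have h2 : (l + d) / (d : ℤ) = l / d + 1 := by
    rw [Int.add_ediv_of_dvd_right dvd_rfl, Int.ediv_self hd]
  rw [modelVec, modelVec, ← Pi.single_smul, h1, h2, smul_eq_mul, ← map_mul, v_mul_vPow]
  congr 3
  ring

variable (d w) in
/-- The relation of the model between the vectors of indices `l` and `l + 1`. -/
def modelRel (l : ℤ) : Fin d → Rtw d w :=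
  op (zerothPoly d w l) • modelVec d w l - op (stepPoly d w l) • modelVec d w (l + 1)

theorem v_smul_modelRel (l : ℤ) : ofFun d w (v d w) • modelRel d w (l + d) = modelRel d w l := by
  rw [modelRel, modelRel, smul_sub, smul_smul, smul_smul, ← taylor_zerothPoly,
    ← taylor_stepPoly (NeZero.ne d), ← op_mul_v, ← op_mul_v, mul_smul, mul_smul, v_smul_modelVec,
    add_right_comm, v_smul_modelVec]

theorem modelRel_add_degree (l : ℤ) :
    modelRel d w (l + d) = ofFun d w (vInv d w) • modelRel d w l := by
  rw [← v_smul_modelRel l, smul_smul, ← map_mul, vInv_mul_v, map_one, one_smul]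

variable (d w) in
/-- The submodule of relations of the model. -/
def modelRels : Submodule (Rtw d w) (Fin d → Rtw d w) :=
  Submodule.span (Rtw d w) (Set.range fun m : Fin d => modelRel d w m)

theorem modelRel_mem (l : ℤ) : modelRel d w l ∈ modelRels d w := by
  have hd' : (0 : ℤ) < d := by exact_mod_cast Nat.pos_of_neZero d
  have h0 : modelRel d w (l % d) ∈ modelRels d w := by
    obtain ⟨m, hm⟩ := Int.eq_ofNat_of_zero_le (Int.emod_nonneg l hd'.ne')
    have := Int.emod_lt_of_pos l hd'
    rw [hm]
    exact Submodule.subset_span ⟨⟨m, by omega⟩, rfl⟩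
  have h (n : ℤ) : modelRel d w (l % d + d * n) ∈ modelRels d w := by
    induction n using Int.induction_on with
    | zero => simpa using h0
    | succ n ih =>
      rw [mul_add, mul_one, ← add_assoc, modelRel_add_degree]
      exact Submodule.smul_mem _ _ ih
    | pred n ih =>
      rw [← v_smul_modelRel, mul_sub, mul_one, add_assoc, sub_add_cancel]
      exact Submodule.smul_mem _ _ ih
  rw [← Int.emod_add_mul_ediv l d]
  exact h _

variable (d w) in
/-- The map from the free module on the symbols to the model. -/
def toModel : FreeModule d w →ₗ[Rtw d w] (Fin d → Rtw d w) :=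
  Finsupp.linearCombination (Rtw d w) fun ν : B d w =>
    op (prodPoly d w (nuInt d w (ν.1 0)) (excess d w ν.1)) • modelVec d w (ν.1 0)

theorem toModel_symbol (ν : B d w) : toModel d w (symbol d w ν) =
    op (prodPoly d w (nuInt d w (ν.1 0)) (excess d w ν.1)) • modelVec d w (ν.1 0) := by
  rw [toModel, symbol, Finsupp.linearCombination_single, one_smul]

/-- The decomposition `ν = ν(l) + (0, k)` is unique, so any such decomposition computes
`toModel`. -/
theorem toModel_symbol_eq {ν : B d w} {l : ℤ} {k : Fin N → ℕ} (h : ν.1 = nuInt d w l + tailVec k) :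
    toModel d w (symbol d w ν) = op (prodPoly d w (nuInt d w l) k) • modelVec d w l := by
  have h0 : ν.1 0 = l := by simp [h, nuInt, tailVec]
  have h1 : excess d w ν.1 = k := by
    funext i
    have := natCast_excess ν.2 i
    rw [h0, h] at this
    simp only [nuInt, tailVec, Pi.add_apply, Fin.cons_succ] at this
    rw [h]
    simp only [nuInt, tailVec]
    omega
  rw [toModel_symbol, h0, h1]

/-- The second and third kinds of relations hold identically in the model, and the first kind gives
multiples of the cyclic relations. -/
theorem toModel_mem_of_isRelation {x : FreeModule d w} (hx : IsRelation d w x) :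
    toModel d w x ∈ modelRels d w := by
  obtain ⟨ν⟩ | ⟨ν, i⟩ | ⟨ν⟩ := hx
  all_goals
    obtain ⟨l, k, h⟩ : ∃ l k, ν.1 = nuInt d w l + tailVec k := ⟨_, _, eq_nuInt_add_tailVec ν.2⟩
    rw [map_sub, map_smul, toModel_symbol_eq h]
  · have h0 : ν.1 0 = l := by simp [h, nuInt, tailVec]
    have h1 : ν.1 + Pi.single 0 1 = nuInt d w (l + 1) + tailVec (jump d w l + k) := by
      rw [h, add_right_comm, nuInt_add_single, add_assoc]
      congr 1
      funext i
      refine Fin.cases ?_ (fun i => ?_) i <;> simp [tailVec]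
    rw [toModel_symbol_eq (l := l + 1) (k := jump d w l + k) h1, ← op_zerothPoly, h0, smul_smul,
      ← op_mul _ (prodPoly_mem _ _), mul_comm, op_mul _ (zerothPoly_mem _), prodPoly_add,
      ← nuInt_add_single, prodPoly_congr (ν := nuInt d w l + Pi.single 0 1) (μ := nuInt d w l)
        (by simp),
      op_mul _ (prodPoly_mem _ _), mul_smul, mul_smul, ← smul_sub]
    exact Submodule.smul_mem _ _ (modelRel_mem l)
  · have h0 : ν.1 i.succ = nuInt d w l i.succ + k i := by simp [h, tailVec]
    have h1 : ν.1 + Pi.single i.succ 1 = nuInt d w l + tailVec (k + Pi.single i 1) := by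
      rw [h, tailVec_add_single, add_assoc]
    rw [toModel_symbol_eq (l := l) (k := k + Pi.single i 1) h1, ← op_linPoly, h0, smul_smul,
      ← op_mul _ (prodPoly_mem _ _), prodPoly_add_single, sub_self]
    exact Submodule.zero_mem _
  · have hl : nuInt d w l + relVec d w = nuInt d w (l - d) := by
      have := nuInt_add_relVec (w := w) (NeZero.ne d) (l - d)
      rwa [sub_add_cancel] at this
    have h1 : ν.1 + relVec d w = nuInt d w (l - d) + tailVec k := by
      rw [h, add_right_comm, hl]
    have h2 := v_smul_modelVec (d := d) (w := w) (l - d)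
    rw [sub_add_cancel] at h2
    rw [toModel_symbol_eq (l := l - d) (k := k) h1, ← h2, smul_smul, smul_smul, op_mul_v,
      taylor_prodPoly hl, sub_self]
    exact Submodule.zero_mem _

end Model

/-! ### Independence -/

section Independence

variable {N : ℕ} {d : ℕ} {w : Fin N → ℕ}

theorem sum_smul_modelVec_mem [NeZero d] {f : Fin d → BaseRing d w}
    (hf : ∑ m, f m • DeltaNu d w m = 0) :
    ∑ m : Fin d, ofFun d w (f m) • modelVec d w (m : ℕ) ∈ modelRels d w := by
  have h1 : ∑ m : Fin d, ofFun d w (f m) • symbol d w ⟨nuVec d w m, nuVec_mem d w m⟩ ∈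
      Submodule.span (Rtw d w) {x | IsRelation d w x} := by
    refine (Submodule.Quotient.mk_eq_zero _).1 (Eq.trans ?_ hf)
    exact map_sum (Submodule.mkQ (Submodule.span (Rtw d w) {x | IsRelation d w x})) _ _
  have h2 : Submodule.span (Rtw d w) {x | IsRelation d w x} ≤
      (modelRels d w).comap (toModel d w) :=
    Submodule.span_le.2 fun x hx => toModel_mem_of_isRelation hx
  have h3 := h2 h1
  rw [Submodule.mem_comap, map_sum] at h3
  refine (congrArg (· ∈ modelRels d w) (Finset.sum_congr rfl fun m _ => ?_)).mp h3
  rw [map_smul, toModel_symbol_eq (l := (m : ℕ)) (k := 0), prodPoly_zero, op_one, one_smul]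
  rw [nuInt_natCast]
  funext i
  refine Fin.cases ?_ (fun i => ?_) i <;> simp [tailVec]

theorem residue_natCast [NeZero d] (m : Fin d) : (residue (m : ℕ) : Fin d) = m := by
  apply Fin.ext
  simp only [residue]
  rw [← Int.natCast_mod, Int.toNat_natCast, Nat.mod_eq_of_lt m.2]

theorem residue_natCast_add_one [NeZero d] (m : Fin d) :
    (residue ((m : ℕ) + 1) : Fin d) = m + 1 := by
  apply Fin.ext
  simp only [residue]
  rw [← Nat.cast_succ, ← Int.natCast_mod, Int.toNat_natCast, Fin.val_add]
  simp

variable (d w) in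
/-- The power of `v` in `modelVec (m + 1)`: it is `1`, except that it is `v⁻¹` for `m = d - 1`. -/
def wrapFactor (m : Fin d) : BaseRing d w := if (m : ℕ) + 1 = d then vInv d w else 1

theorem vPow_neg_ediv [NeZero d] (m : Fin d) :
    vPow d w (-((((m : ℕ) : ℤ) + 1) / d)) = wrapFactor d w m := by
  have := m.2
  by_cases h : (m : ℕ) + 1 = d
  · rw [wrapFactor, if_pos h, ← Nat.cast_succ, Nat.succ_eq_add_one, h, Int.ediv_self
      (by exact_mod_cast NeZero.ne d), vPow_neg_one]
  · rw [wrapFactor, if_neg h, Int.ediv_eq_zero_of_lt (by omega) (by omega), neg_zero, vPow_zero]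

theorem modelVec_natCast [NeZero d] (m : Fin d) : modelVec d w (m : ℕ) = Pi.single m 1 := by
  rw [modelVec, residue_natCast, Int.ediv_eq_zero_of_lt (by omega) (by omega), neg_zero, vPow_zero,
    map_one]

theorem modelVec_natCast_add_one [NeZero d] (m : Fin d) :
    modelVec d w ((m : ℕ) + 1) = Pi.single (m + 1) (ofFun d w (wrapFactor d w m)) := by
  rw [modelVec, residue_natCast_add_one, vPow_neg_ediv]

variable (d w) in
/-- The Taylor shift that moves `wrapFactor m` across a differential operator. -/
def wrapShift (m : Fin d) : BaseRing d w := if (m : ℕ) + 1 = d then -z d w else 0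

theorem op_mul_wrapFactor (m : Fin d) (p : (BaseRing d w)[X]) :
    op p * ofFun d w (wrapFactor d w m) =
      op (C (wrapFactor d w m) * taylor (wrapShift d w m) p) := by
  rw [op_C_mul, wrapFactor, wrapShift]
  split_ifs
  · exact op_mul_vInv p
  · rw [map_one, taylor_zero, mul_one, one_mul]

theorem prod_wrapFactor (hd : d ≠ 0) : ∏ m, wrapFactor d w m = vInv d w := by
  rw [Finset.prod_eq_single (⟨d - 1, by omega⟩ : Fin d)]
  · exact if_pos (Nat.succ_pred_eq_of_ne_zero hd)
  · intro m _ hm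
    refine if_neg fun h => hm (Fin.ext ?_)
    simp only
    omega
  · exact fun h => absurd (Finset.mem_univ _) h

theorem age_val_add_one [NeZero d] (hCY : d = ∑ j, w j) (m : Fin d) :
    age d w ((m + 1 : Fin d) : ℕ) = age d w ((m : ℕ) + 1) := by
  have h1 := m.2
  by_cases h : (m : ℕ) + 1 = d
  · have h2 : ((m + 1 : Fin d) : ℕ) = 0 := by
      rw [Fin.val_add]
      simp [h]
    have h3 := age_add_degree (w := w) (NeZero.ne d) hCY 0
    rw [zero_add] at h3
    rw [h2, ← Nat.cast_succ, Nat.succ_eq_add_one, h, h3, Nat.cast_zero]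
  · have h2 : ((m + 1 : Fin d) : ℕ) = m + 1 := by
      rw [Fin.val_add]
      simp [Nat.mod_eq_of_lt (show (m : ℕ) + 1 < d by omega)]
    rw [h2, Nat.cast_succ]

theorem linearIndependent_DeltaNu (hd : d ≠ 0) (hCY : d = ∑ j, w j) :
    LinearIndependent (BaseRing d w) fun l : Fin d => DeltaNu d w l := by
  have : NeZero d := ⟨hd⟩
  rw [Fintype.linearIndependent_iff]
  intro f hf
  obtain ⟨r, hr⟩ := (Submodule.mem_span_range_iff_exists_fun _).1 (sum_smul_modelVec_mem hf)
  choose p hp using fun m => op_surjective (r m)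
  have key (m : Fin d) : C (f (m + 1)) = p (m + 1) * zerothPoly d w ((m + 1 : Fin d) : ℕ) -
      C (wrapFactor d w m) * taylor (wrapShift d w m) (p m * stepPoly d w (m : ℕ)) := by
    have h := congrFun hr (m + 1)
    simp only [modelRel, modelVec_natCast, modelVec_natCast_add_one, Finset.sum_apply,
      Pi.smul_apply, Pi.sub_apply, smul_eq_mul, Pi.single_apply, add_left_inj, mul_ite, mul_sub,
      mul_one, mul_zero, Finset.sum_sub_distrib, Finset.sum_ite_eq, Finset.mem_univ, if_true] at h
    rw [← hp, ← hp, ← op_mul _ (zerothPoly_mem _), ← mul_assoc,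
      ← op_mul _ (show stepPoly d w (m : ℕ) ∈ constPoly d w from prodPoly_mem _ _),
      op_mul_wrapFactor, ← map_sub, ← op_C] at h
    exact (op_injective h).symm
  have hp0 : p = 0 := by
    refine eq_zero_of_cyclic_system (a := fun m => age d w (m : ℕ))
      (s := fun m => ∑ i, jump d w (m : ℕ) i) (Z := fun m => zerothPoly d w (m : ℕ))
      (S := fun m => stepPoly d w (m : ℕ)) (δ := fun _ => (d : BaseRing d w))
      (u := wrapFactor d w) (γ := wrapShift d w)
      (c := fun m => ∏ i, (w i : BaseRing d w) ^ jump d w (m : ℕ) i)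
      (fun m => ?_) (fun m => zerothPoly_natDegree_le _) (fun m => zerothPoly_coeff_one _)
      (fun m => Nat.cast_ne_zero.2 hd) (fun m => prodPoly_natDegree_le _ _)
      (fun m => prodPoly_coeff_sum _ _) ?_ key
    · rw [age_val_add_one hCY]
      exact age_succ hd hCY _
    · have h1 := prod_prod_jump (w := w) hd 0
      simp only [zero_add] at h1
      rw [Finset.prod_mul_distrib, prod_wrapFactor hd, Fin.prod_univ_eq_prod_range
        (fun j => ∏ i, (w i : BaseRing d w) ^ jump d w (j : ℕ) i) d, h1, Finset.prod_const,
        Finset.card_univ, Fintype.card_fin]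
      intro h2
      refine (isUnit_discriminant (w := w) hd).ne_zero ?_
      rw [h2, mul_right_comm, vInv_mul_v, one_mul, sub_self]
  intro m
  have := key (m - 1)
  rw [hp0] at this
  simpa using this

theorem exists_basis_DeltaNu (hd : d ≠ 0) (hCY : d = ∑ j, w j) :
    ∃ b : Module.Basis (Fin d) (BaseRing d w) (Ftw d w), ∀ l : Fin d, b l = DeltaNu d w l :=
  ⟨.mk (linearIndependent_DeltaNu hd hCY) (span_DeltaNu hd hCY).ge, fun l =>
    Module.Basis.mk_apply _ _ l⟩

end Independence

end GKZ

end

theorem mainTheorem11 (N d : ℕ) (w : Fin N → ℕ)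
    (hpos : ∀ j, 0 < w j)
    (hcoprime : Finset.univ.gcd w = 1)
    (hCY : d = ∑ j, w j)
    (hGor : ∀ j, w j ∣ d) :
    (∃ b : Module.Basis (Fin d) (GKZ.BaseRing d w) (GKZ.Ftw d w),
      ∀ l : Fin d, b l = GKZ.DeltaNu d w l) ∧
    ∀ U : (GKZ.Base d w).Opens,
      ∃ b : Module.Basis (Fin d) Γ(GKZ.Base d w, U) Γ(GKZ.FtwSheaf d w, U),
        ∀ l : Fin d, b l = GKZ.toSection d w U (GKZ.DeltaNu d w l) := by
  have hd : d ≠ 0 := by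
    rintro rfl
    rcases N with _ | N
    · simp at hcoprime
    · exact (hpos 0).ne' (Finset.sum_eq_zero_iff.1 hCY.symm 0 (Finset.mem_univ _))
  obtain ⟨b, hb⟩ := GKZ.exists_basis_DeltaNu hd hCY
  refine ⟨⟨b, hb⟩, fun U => ?_⟩
  obtain ⟨b', hb'⟩ := GKZ.exists_basis_sections b U
  exact ⟨b', fun l => (hb' l).trans (congrArg _ (hb l))⟩
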